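/- **Model.** Fix integers $m\ge 1$ and $k$, a matrix $\Pi_0\in\mathbb R^{k\times m}$ of full column rank $m$ (so $k\ge m$) and $\beta_0\in\mathbb R^m$. For every sample size $n$ let $Z\in\mathbb R^{n\times k}$, $V_X\in\mathbb R^{n\times m}$ and $\varepsilon\in\mathbb R^n$ be random, and let $$X=Z\,\tfrac{1}{\sqrt n}\Pi_0+V_X\in\mathbb R^{n\times m},\qquad y=X\beta_0+\varepsilon\in\mathbb R^n .$$ **Assumption.** Let $\Psi=(Z^TZ)^{-1/2}Z^T(\varepsilon\ V_X)\in\mathbb R^{k\times(1+m)}$. There are positive definite matrices $\Omega=\begin{pmatrix}\sigma_\varepsilon^2&\Omega_{\varepsilon,V}\\ \Omega_{V,\varepsilon}&\Omega_V\end{pmatrix}\in\mathbb R^{(1+m)\times(1+m)}$ and $Q\in\mathbb R^{k\times k}$ such that, as $n\to\infty$, (a) $\frac1n(\varepsilon\ V_X)^T(\varepsilon\ V_X)\to\Omega$ in probability, (b) $\operatorname{vec}(\Psi)\to\mathcal N(0,\Omega\otimes \mathrm{Id}_k)$ in distribution, (c) $\frac1nZ^TZ\to Q$ in probability. **Statistics.**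 Let $P_Z=Z(Z^TZ)^{-1}Z^T$ and $M_Z=\mathrm{Id}_n-P_Z$. Let $$\mathrm{LR}(\beta)=(n-k)\frac{(y-X\beta)^TP_Z(y-X\beta)}{(y-X\beta)^TM_Z(y-X\beta)}-(n-k)\inf_b\frac{(y-Xb)^TP_Z(y-Xb)}{(y-Xb)^TM_Z(y-Xb)},$$ $$\tilde X(\beta)=X-(y-X\beta)\frac{(y-X\beta)^TM_ZX}{(y-X\beta)^TM_Z(y-X\beta)},$$ and let $\lambda_1(\beta)\le\dots\le\lambda_m(\beta)$ be the eigenvalues of $(n-k)\,[\tilde X(\beta)^TM_Z\tilde X(\beta)]^{-1}\tilde X(\beta)^TP_Z\tilde X(\beta)$. Write $\lambda^{(n)}=(\lambda_1(\beta_0),\dots,\lambda_m(\beta_0))$. (With probability tending to one all these inverses and quotients exist; elsewhere the values do not matter for the limits.) **Limit.** Let $q_0\sim\chi^2(k-m)$ and $q_1,\dots,q_m\sim\chi^2(1)$ be independent ($\chi^2(0)$ is the point mass at $0$), write $q=(q_0,\dots,q_m)$, and let $\mu_{\min}(\lambda,q)$ be the smallest root of $$p_{\lambda,q}(\mu)=\Bigl(\mu-\sum_{i=0}^mq_i\Bigr)\prod_{i=1}^m(\mu-\lambda_i)-\sum_{i=1}^m\lambda_iq_i\prod_{j\ge1,\,j\ne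 i}(\mu-\lambda_j).$$ Put $L(\lambda,q)=\sum_{i=0}^mq_i-\mu_{\min}(\lambda,q)$. Let $G$ be a random $k\times m$ matrix, independent of $q$, with $\operatorname{vec}(G)\sim\mathcal N(\operatorname{vec}(Q^{1/2}\Pi_0),\tilde\Omega_V\otimes\mathrm{Id}_k)$, where $\tilde\Omega_V=\Omega_V-\Omega_{V,\varepsilon}\Omega_{\varepsilon,V}/\sigma_\varepsilon^2$, and let $\Lambda=(\Lambda_1\le\dots\le\Lambda_m)$ be the eigenvalues of $\tilde\Omega_V^{-1}G^TG$. **Theorem.** 1. For all $0\le\lambda_1\le\dots\le\lambda_m$ and $q_0,\dots,q_m\ge0$, the polynomial $p_{\lambda,q}$ has a smallest real root $\mu_{\min}(\lambda,q)$, and $0\le\mu_{\min}(\lambda,q)\le\min(\lambda_1,q_0)$. 2. Conditionally on $\lambda_1(\beta_0),\dots,\lambda_m(\beta_0)$, $\mathrm{LR}(\beta_0)\to_d\sum_{i=0}^mq_i-\mu_{\min}(\lambda_1(\beta_0),\dots,\lambda_m(\beta_0),q_0,\dots,q_m)$ as $n\to\infty$, in the following sense: - (joint limit) $(\lambda^{(n)},\mathrm{LR}(\beta_0))\to_d(\Lambda,L(\Lambda,q))$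 with $q$ independent of $\Lambda$, so that the limit of $\mathrm{LR}(\beta_0)$ has, given $\Lambda=\lambda$, the law of $L(\lambda,q)$; - (conditioning on events) for every Borel set $A\subseteq\mathbb R^m$ with $\mathbb P(\Lambda\in\partial A)=0<\mathbb P(\Lambda\in A)$ and every bounded continuous $f:\mathbb R\to\mathbb R$, $\mathbb E[f(\mathrm{LR}(\beta_0))\mid\lambda^{(n)}\in A]\to\mathbb E[f(L(\Lambda,q))\mid\Lambda\in A]$; - (sample eigenvalues in the limit law) for every bounded continuous $F:\mathbb R^m\times\mathbb R\to\mathbb R$, $\mathbb E[F(\lambda^{(n)},\mathrm{LR}(\beta_0))]-\mathbb E[F(\lambda^{(n)},L(\lambda^{(n)},q))]\to0$, where $q$ is taken independent of $\lambda^{(n)}$. -/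

import Mathlib

open MeasureTheory ProbabilityTheory Filter Topology Polynomial
open scoped Matrix Kronecker BoundedContinuousFunction

namespace WeakIV

noncomputable section

/-- The symmetric square root `A ^ (1/2)` of a positive semidefinite matrix. -/
def matSqrt {k : ℕ} (A : Matrix (Fin k) (Fin k) ℝ) : Matrix (Fin k) (Fin k) ℝ :=
  cfc Real.sqrt A

/-- The symmetric inverse square root `A ^ (-1/2)` of a positive definite matrix. -/
def matInvSqrt {k : ℕ} (A : Matrix (Fin k) (Fin k) ℝ) : Matrix (Fin k) (Fin k) ℝ :=
  cfc (fun x : ℝ => (Real.sqrt x)⁻¹) A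

/-- The projection `P_Z = Z (Zᵀ Z)⁻¹ Zᵀ` onto the column space of `Z`. -/
def projZ {n k : ℕ} (Z : Matrix (Fin n) (Fin k) ℝ) : Matrix (Fin n) (Fin n) ℝ :=
  Z * (Zᵀ * Z)⁻¹ * Zᵀ

/-- The projection `M_Z = 1 - P_Z` onto the orthogonal complement of the column space of `Z`. -/
def annihZ {n k : ℕ} (Z : Matrix (Fin n) (Fin k) ℝ) : Matrix (Fin n) (Fin n) ℝ :=
  1 - projZ Z

/-- The eigenvalues of a square matrix with real spectrum, counted with algebraic multiplicity and
sorted in ascending order. -/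
def sortedEigenvalues {m : ℕ} (A : Matrix (Fin m) (Fin m) ℝ) : Fin m → ℝ :=
  fun i => (A.charpoly.roots.sort (· ≤ ·)).getD i 0

section Statistics

variable {n k m : ℕ} (Z : Matrix (Fin n) (Fin k) ℝ) (X : Matrix (Fin n) (Fin m) ℝ)
  (y : Fin n → ℝ)

/-- `(y - X b)ᵀ P_Z (y - X b)` -/
def explainedSS (b : Fin m → ℝ) : ℝ :=
  (y - X *ᵥ b) ⬝ᵥ (projZ Z *ᵥ (y - X *ᵥ b))

/-- `(y - X b)ᵀ M_Z (y - X b)` -/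
def residualSS (b : Fin m → ℝ) : ℝ :=
  (y - X *ᵥ b) ⬝ᵥ (annihZ Z *ᵥ (y - X *ᵥ b))

/-- The likelihood-ratio statistic `LR(β)`. The infimum runs over all `b` for which the quotient is
defined; with probability tending to one these are all `b`. -/
def likelihoodRatio (β : Fin m → ℝ) : ℝ :=
  ((n : ℝ) - k) * (explainedSS Z X y β / residualSS Z X y β)
    - ((n : ℝ) - k) *
      ⨅ b : {b : Fin m → ℝ // residualSS Z X y b ≠ 0},
        explainedSS Z X y b.1 / residualSS Z X y b.1

/-- `X̃(β) = X - (y - X β) ((y - X β)ᵀ M_Z X) / ((y - X β)ᵀ M_Z (y - X β))` -/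
def xTilde (β : Fin m → ℝ) : Matrix (Fin n) (Fin m) ℝ :=
  X - Matrix.vecMulVec (y - X *ᵥ β)
    ((residualSS Z X y β)⁻¹ • ((y - X *ᵥ β) ᵥ* (annihZ Z * X)))

/-- `(n - k) [X̃(β)ᵀ M_Z X̃(β)]⁻¹ X̃(β)ᵀ P_Z X̃(β)` -/
def concentrationMatrix (β : Fin m → ℝ) : Matrix (Fin m) (Fin m) ℝ :=
  ((n : ℝ) - k) • (((xTilde Z X y β)ᵀ * annihZ Z * xTilde Z X y β)⁻¹ *
    ((xTilde Z X y β)ᵀ * projZ Z * xTilde Z X y β))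

/-- `λ₁(β) ≤ … ≤ λₘ(β)`, the eigenvalues of the concentration matrix. -/
def lambdas (β : Fin m → ℝ) : Fin m → ℝ :=
  sortedEigenvalues (concentrationMatrix Z X y β)

end Statistics

/-- The `n × (1 + m)` matrix `(ε V_X)`. -/
def errorMatrix {n m : ℕ} (ε : Fin n → ℝ) (V : Matrix (Fin n) (Fin m) ℝ) :
    Matrix (Fin n) (Fin (m + 1)) ℝ :=
  Matrix.of fun i => (Fin.cons (ε i) (V i) : Fin (m + 1) → ℝ)

/-- `Ψ = (Zᵀ Z)^(-1/2) Zᵀ (ε V_X)` -/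
def Psi {n k m : ℕ} (Z : Matrix (Fin n) (Fin k) ℝ) (ε : Fin n → ℝ)
    (V : Matrix (Fin n) (Fin m) ℝ) : Matrix (Fin k) (Fin (m + 1)) ℝ :=
  matInvSqrt (Zᵀ * Z) * (Zᵀ * errorMatrix ε V)

/-- The linear instrumental variables model under weak instrument asymptotics. For each sample size
`n`, the rows of `Z n`, `X n`, `V n` and the entries of `y n`, `ε n` are the observations
`1, …, n`; the first-stage parameter at sample size `n` is `n^(-1/2) Pi0`. -/
structure Model {Ω : Type*} [MeasurableSpace Ω] {k m : ℕ}
    (Pi0 : Matrix (Fin k) (Fin m) ℝ) (β₀ : Fin m → ℝ)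
    (Z : (n : ℕ) → Ω → Matrix (Fin n) (Fin k) ℝ) (X : (n : ℕ) → Ω → Matrix (Fin n) (Fin m) ℝ)
    (y : (n : ℕ) → Ω → Fin n → ℝ) (ε : (n : ℕ) → Ω → Fin n → ℝ)
    (V : (n : ℕ) → Ω → Matrix (Fin n) (Fin m) ℝ) : Prop where
  measurable_Z : ∀ n i j, Measurable fun ω => Z n ω i j
  measurable_ε : ∀ n i, Measurable fun ω => ε n ω i
  measurable_V : ∀ n i j, Measurable fun ω => V n ω i j
  fullRank : Pi0.rank = m
  firstStage : ∀ n ω, X n ω = Z n ω * ((Real.sqrt n)⁻¹ • Pi0) + V n ω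
  outcome : ∀ n ω, y n ω = X n ω *ᵥ β₀ + ε n ω

/-- The high-level limit assumptions, with limits `Om` (the error covariance `Ω`) and `Q`.
Convergence of matrices in probability is entrywise. -/
structure LimitAssumption {Ω : Type*} [MeasurableSpace Ω] (P : Measure Ω) [IsProbabilityMeasure P]
    {k m : ℕ} (Om : Matrix (Fin (m + 1)) (Fin (m + 1)) ℝ) (Q : Matrix (Fin k) (Fin k) ℝ)
    (Z : (n : ℕ) → Ω → Matrix (Fin n) (Fin k) ℝ) (ε : (n : ℕ) → Ω → Fin n → ℝ)
    (V : (n : ℕ) → Ω → Matrix (Fin n) (Fin m) ℝ) : Prop where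
  posDef_Om : Om.PosDef
  posDef_Q : Q.PosDef
  errors : ∀ i j, TendstoInMeasure P
    (fun (n : ℕ) ω =>
      ((n : ℝ)⁻¹ • ((errorMatrix (ε n ω) (V n ω))ᵀ * errorMatrix (ε n ω) (V n ω))) i j)
    atTop (fun _ => Om i j)
  clt : TendstoInDistribution
    (fun (n : ℕ) ω => WithLp.toLp 2 (Matrix.vec (Psi (Z n ω) (ε n ω) (V n ω)))) atTop
    (id : EuclideanSpace ℝ (Fin (m + 1) × Fin k) → EuclideanSpace ℝ (Fin (m + 1) × Fin k))
    (fun _ => P) (multivariateGaussian 0 (Om ⊗ₖ (1 : Matrix (Fin k) (Fin k) ℝ)))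
  instruments : ∀ i j, TendstoInMeasure P
    (fun (n : ℕ) ω => ((n : ℝ)⁻¹ • ((Z n ω)ᵀ * Z n ω)) i j) atTop (fun _ => Q i j)

/-- The chi-squared distribution with `d` degrees of freedom, the law of the sum of squares of `d`
independent standard normal variables; for `d = 0` it is the point mass at zero. -/
def chiSquared (d : ℕ) : Measure ℝ :=
  (Measure.pi fun _ : Fin d => gaussianReal 0 1).map fun x => ∑ i, x i ^ 2

/-- The polynomial
`(μ - ∑ i, q i) * ∏ i, (μ - λ i) - ∑ i, λ i * q i * ∏ j ≠ i, (μ - λ j)` in `μ`.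
The coordinates of `q` are `q₀, …, qₘ` and those of `lam` are `λ₁, …, λₘ`. -/
def limitPoly {m : ℕ} (lam : Fin m → ℝ) (q : Fin (m + 1) → ℝ) : ℝ[X] :=
  (X - C (∑ i, q i)) * ∏ i, (X - C (lam i))
    - ∑ i : Fin m, C (lam i * q i.succ) * ∏ j ∈ Finset.univ.erase i, (X - C (lam j))

/-- The smallest real root of `limitPoly`. -/
def muMin {m : ℕ} (lam : Fin m → ℝ) (q : Fin (m + 1) → ℝ) : ℝ :=
  sInf {μ : ℝ | (limitPoly lam q).IsRoot μ}

/-- `∑ i, q i - μ_min(λ, q)` -/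
def limitLR {m : ℕ} (lam : Fin m → ℝ) (q : Fin (m + 1) → ℝ) : ℝ :=
  ∑ i, q i - muMin lam q

/-- The Schur complement `Ω_V - Ω_{V,ε} Ω_{ε,V} / σ_ε²` of the `ε`-entry of `Ω`. -/
def condCov {m : ℕ} (Om : Matrix (Fin (m + 1)) (Fin (m + 1)) ℝ) : Matrix (Fin m) (Fin m) ℝ :=
  Matrix.of fun i j => Om i.succ j.succ - Om i.succ 0 * Om 0 j.succ / Om 0 0

/-- The law of `vec G` for a `k × m` matrix `G` that is normal with mean `Q^(1/2) Pi0`, with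
independent rows of covariance `condCov Om`. -/
def limitGaussian {k m : ℕ} (Om : Matrix (Fin (m + 1)) (Fin (m + 1)) ℝ)
    (Q : Matrix (Fin k) (Fin k) ℝ) (Pi0 : Matrix (Fin k) (Fin m) ℝ) :
    Measure (EuclideanSpace ℝ (Fin m × Fin k)) :=
  multivariateGaussian (WithLp.toLp 2 (Matrix.vec (matSqrt Q * Pi0)))
    (condCov Om ⊗ₖ (1 : Matrix (Fin k) (Fin k) ℝ))

instance isProbabilityMeasure_limitGaussian {k m : ℕ}
    (Om : Matrix (Fin (m + 1)) (Fin (m + 1)) ℝ)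
    (Q : Matrix (Fin k) (Fin k) ℝ) (Pi0 : Matrix (Fin k) (Fin m) ℝ) :
    IsProbabilityMeasure (limitGaussian Om Q Pi0) := by
  unfold limitGaussian; infer_instance

/-- The eigenvalues of `(condCov Om)⁻¹ Gᵀ G`, where `g = vec G`. -/
def limitLambdas {k m : ℕ} (Om : Matrix (Fin (m + 1)) (Fin (m + 1)) ℝ)
    (g : EuclideanSpace ℝ (Fin m × Fin k)) : Fin m → ℝ :=
  let G : Matrix (Fin k) (Fin m) ℝ := Matrix.of fun i j => g (j, i)
  sortedEigenvalues ((condCov Om)⁻¹ * (Gᵀ * G))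

end

end WeakIV

open WeakIV

/-! Everything reduces to two matrices: `S = (ZᵀZ)^(-1/2) Zᵀ(ε X)` and `W = (ε X)ᵀ M_Z (ε X) / (n -
k)`. At the true parameter, `X̃ = (ε X) T` with `T = schurMatrix W`, so the eigenvalue statistic is
the spectrum of `(condCov W)⁻¹ (S T)ᵀ(S T)`. Since `y - X b = (ε X)(1, β₀ - b)`, the infimum in the
likelihood ratio is a Rayleigh quotient over the slice `v 0 = 1`. That slice meets a dense set of
directions, so the infimum is the least eigenvalue of `W⁻¹ SᵀS` (`statistics_eq`).

Both `S` and `W` are functions of `Ψ`, `(ε V)ᵀ(ε V)/n`, `ZᵀZ/n` and `1/n`, continuous where the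
matrices involved are positive definite. The last three converge in probability to constants, so
Slutsky and a continuous mapping theorem give the joint limit
(`tendstoInDistribution_of_continuousOn`).

To identify the limit, regress the last `m` columns of the Gaussian limit of `Ψ` on its first column
`σ ξ`. The regression residual, recentred, is `G`; it is independent of the standard normal vector
`ξ`, and in the limit `S T = G` (`map_psiOfPair`). With `G` fixed, diagonalise `condCov Ω` and `GᵀG`
simultaneously. This turns `W⁻¹ SᵀS` into a matrix with the characteristic polynomial of an arrow
matrix with corner `|ξ|²`, border `√λⱼ ⟨bⱼ, ξ⟩` and diagonal `λ`, for an orthonormal basis `b`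
depending on `G` only (`exists_basis_momentLR`). That polynomial is `limitPoly`, with `qⱼ = ⟨bⱼ,
ξ⟩²` and `q₀` the squared length of the rest of `ξ`. By rotation invariance the law of `q` does not
depend on `b`, hence not on `G`; Fubini turns this into independence (`map_momentMap_limitMoments`).

The bounds on the smallest root hold because `limitPoly` is the characteristic polynomial of a
symmetric arrow matrix whose quadratic form is a sum of squares. The conditional statements follow
from the joint limit: the first by testing with indicators of continuity sets, the second because `λ
↦ E F(λ, L(λ, q))` extends to a bounded continuous function. -/

namespace WeakIV

/-! ### Sorted eigenvalues: continuity and simultaneous diagonalisation -/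

section SortedEigenvalues

variable {m : ℕ}

theorem prod_X_sub_C_roots (f : Fin m → ℝ) :
    (∏ i, (X - C (f i))).roots = ((List.ofFn f : List ℝ) : Multiset ℝ) := by
  rw [Polynomial.roots_prod _ _ (Finset.prod_ne_zero_iff.2 fun i _ => X_sub_C_ne_zero _)]
  simp only [roots_X_sub_C, Multiset.bind_singleton]
  rw [← Fin.univ_val_map]

theorem sortedEigenvalues_eq_of_charpoly {A : Matrix (Fin m) (Fin m) ℝ} {f : Fin m → ℝ}
    (hf : Monotone f) (h : A.charpoly = ∏ i, (X - C (f i))) : sortedEigenvalues A = f := by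
  have hs : (A.charpoly.roots.sort (· ≤ ·)) = List.ofFn f := by
    rw [h, prod_X_sub_C_roots]
    apply List.Perm.eq_of_pairwise' (r := (· ≤ ·))
    · exact Multiset.pairwise_sort _ _
    · exact (hf.sortedLE_ofFn).pairwise
    · rw [← Multiset.coe_eq_coe, Multiset.sort_eq]
  funext i
  simp [sortedEigenvalues, hs]

/-- Splitting forces exactly `m` roots with multiplicity, so the default value in
`sortedEigenvalues` is never read. -/
theorem sortedEigenvalues_spec {A : Matrix (Fin m) (Fin m) ℝ} (h : A.charpoly.Splits) :
    Monotone (sortedEigenvalues A) ∧ A.charpoly = ∏ i, (X - C (sortedEigenvalues A i)) := by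
  have hlen : (A.charpoly.roots.sort (· ≤ ·)).length = m := by
    rw [Multiset.length_sort, ← h.natDegree_eq_card_roots]; simp
  obtain ⟨f, hf⟩ : ∃ f : Fin m → ℝ, A.charpoly.roots.sort (· ≤ ·) = List.ofFn f :=
    ⟨fun i => (A.charpoly.roots.sort (· ≤ ·)).get (i.cast hlen.symm), by
      apply List.ext_get <;> simp [hlen]⟩
  have hfm : Monotone f := by
    rw [← List.sortedLE_ofFn_iff, ← hf]
    exact (Multiset.pairwise_sort _ _).sortedLE
  have hc : A.charpoly = ∏ i, (X - C (f i)) := by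
    conv_lhs => rw [h.eq_prod_roots_of_monic A.charpoly_monic,
      ← Multiset.sort_eq A.charpoly.roots (· ≤ ·),
      hf, ← Fin.univ_val_map]
    simp [List.prod_ofFn]
  rw [sortedEigenvalues_eq_of_charpoly hfm hc]
  exact ⟨hfm, hc⟩

theorem eq_of_prod_X_sub_C_eq {f g : Fin m → ℝ} (hf : Monotone f) (hg : Monotone g)
    (h : ∏ i, (X - C (f i)) = ∏ i, (X - C (g i))) : f = g := by
  have h2 := congrArg Polynomial.roots h
  rw [prod_X_sub_C_roots, prod_X_sub_C_roots, Multiset.coe_eq_coe] at h2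
  exact List.ofFn_injective (List.Perm.eq_of_pairwise' (r := (· ≤ ·)) hf.sortedLE_ofFn.pairwise
    hg.sortedLE_ofFn.pairwise h2)

theorem sortedEigenvalues_isRoot {A : Matrix (Fin m) (Fin m) ℝ} (h : A.charpoly.Splits)
    (i : Fin m) : A.charpoly.IsRoot (sortedEigenvalues A i) := by
  rw [(sortedEigenvalues_spec h).2, IsRoot, eval_prod]
  exact Finset.prod_eq_zero (Finset.mem_univ i) (by simp)

/-- Gershgorin: the eigenvalue lies in a disc whose centre and radius together are bounded by an
absolute row sum. This supplies the local bound for continuity. -/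
theorem abs_sortedEigenvalues_le {A : Matrix (Fin m) (Fin m) ℝ} (h : A.charpoly.Splits)
    (i : Fin m) : |sortedEigenvalues A i| ≤ ∑ k, ∑ j, |A k j| := by
  have hr := sortedEigenvalues_isRoot h i
  have hev : Module.End.HasEigenvalue (Matrix.toLin' A) (sortedEigenvalues A i) := by
    rw [Module.End.hasEigenvalue_iff_isRoot_charpoly, Matrix.charpoly_toLin']; exact hr
  obtain ⟨k, hk⟩ := eigenvalue_mem_ball hev
  rw [Metric.mem_closedBall, Real.dist_eq] at hk
  have h1 : |sortedEigenvalues A i| ≤ ∑ j, |A k j| := by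
    rw [← Finset.add_sum_erase _ _ (Finset.mem_univ k)]
    have := abs_sub_abs_le_abs_sub (sortedEigenvalues A i) (A k k)
    simp only [Real.norm_eq_abs] at hk
    linarith
  exact h1.trans (Finset.single_le_sum (f := fun k => ∑ j, |A k j|)
    (fun k _ => Finset.sum_nonneg fun j _ => abs_nonneg _) (Finset.mem_univ k))

/-- A compactness argument: near `A` the sorted spectra stay in a compact set of monotone vectors.
Any cluster point has the coefficients of `A.charpoly` in the limit, and a monotone root vector is
determined by its polynomial, so the cluster point is unique. -/
theorem continuousOn_sortedEigenvalues :
    ContinuousOn (sortedEigenvalues (m := m)) {A | A.charpoly.Splits} := by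
  intro A hA
  set R : ℝ := (∑ k, ∑ j, |A k j|) + 1
  have hcont : Continuous fun B : Matrix (Fin m) (Fin m) ℝ => ∑ k, ∑ j, |B k j| := by
    fun_prop
  have hev : ∀ᶠ B in 𝓝[{A | A.charpoly.Splits}] A, B.charpoly.Splits ∧ ∑ k, ∑ j, |B k j| < R := by
    refine Filter.Eventually.and self_mem_nhdsWithin (nhdsWithin_le_nhds ?_)
    exact hcont.continuousAt.eventually_lt continuousAt_const (by simp [R])
  have hK : IsCompact ({r : Fin m → ℝ | Monotone r} ∩ Set.pi Set.univ fun _ => Set.Icc (-R) R) := by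
    refine IsCompact.inter_left (isCompact_univ_pi fun _ => isCompact_Icc) ?_
    simp only [Monotone, Set.ofPred_forall]
    refine isClosed_iInter fun a => isClosed_iInter fun b => isClosed_iInter fun _ => ?_
    exact isClosed_le (by fun_prop) (by fun_prop)
  refine hK.tendsto_nhds_of_unique_mapClusterPt ?_ ?_
  · filter_upwards [hev] with B hB
    refine ⟨(sortedEigenvalues_spec hB.1).1, fun i _ => ?_⟩
    exact abs_le.1 ((abs_sortedEigenvalues_le hB.1 i).trans hB.2.le)
  · rintro r ⟨hr, -⟩ hcl
    refine eq_of_prod_X_sub_C_eq hr (sortedEigenvalues_spec hA).1 ?_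
    rw [← (sortedEigenvalues_spec hA).2]
    refine Polynomial.funext fun x => ?_
    have h1 : MapClusterPt ((∏ i, (X - C (r i)) : ℝ[X]).eval x) (𝓝[{A | A.charpoly.Splits}] A)
        ((fun r : Fin m → ℝ => (∏ i, (X - C (r i)) : ℝ[X]).eval x) ∘ sortedEigenvalues) := by
      refine MapClusterPt.continuousAt_comp (f := fun r : Fin m → ℝ =>
        (∏ i, (X - C (r i)) : ℝ[X]).eval x) (Continuous.continuousAt ?_) hcl
      simp only [eval_prod, eval_sub, eval_X, eval_C]
      fun_prop
    have h2 : Tendsto ((fun r : Fin m → ℝ => (∏ i, (X - C (r i)) : ℝ[X]).eval x) ∘ sortedEigenvalues)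
        (𝓝[{A | A.charpoly.Splits}] A) (𝓝 (A.charpoly.eval x)) := by
      have h3 : Tendsto (fun B : Matrix (Fin m) (Fin m) ℝ => B.charpoly.eval x)
          (𝓝[{A | A.charpoly.Splits}] A) (𝓝 (A.charpoly.eval x)) := by
        refine Tendsto.mono_left (Continuous.tendsto ?_ A) nhdsWithin_le_nhds
        simp only [Matrix.eval_charpoly]
        fun_prop
      refine h3.congr' ?_
      filter_upwards [self_mem_nhdsWithin] with B hB
      simp only [Function.comp]
      rw [← (sortedEigenvalues_spec hB).2]
    exact eq_of_nhds_neBot (ClusterPt.mono h1 h2)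

theorem exists_orthogonal_diagonal_sortedEigenvalues {A : Matrix (Fin m) (Fin m) ℝ}
    (hA : Aᵀ = A) : ∃ O : Matrix (Fin m) (Fin m) ℝ, Oᵀ * O = 1 ∧
      Oᵀ * A * O = Matrix.diagonal (sortedEigenvalues A) := by
  have hH : A.IsHermitian := by
    rw [Matrix.IsHermitian, Matrix.conjTranspose_eq_transpose_of_trivial, hA]
  set O₁ : Matrix (Fin m) (Fin m) ℝ := (hH.eigenvectorUnitary : Matrix (Fin m) (Fin m) ℝ)
  have hO₁ : O₁ᵀ * O₁ = 1 := by
    have := Unitary.coe_star_mul_self hH.eigenvectorUnitary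
    rwa [Matrix.star_eq_conjTranspose, Matrix.conjTranspose_eq_transpose_of_trivial] at this
  have hd : O₁ᵀ * A * O₁ = Matrix.diagonal hH.eigenvalues := by
    have := hH.conjStarAlgAut_star_eigenvectorUnitary
    rw [Unitary.conjStarAlgAut_star_apply] at this
    rw [Matrix.star_eq_conjTranspose, Matrix.conjTranspose_eq_transpose_of_trivial] at this
    exact this
  -- The spectral theorem need not list eigenvalues in ascending order; permuting the columns of the
  -- orthogonal matrix corrects this.
  set σ := Tuple.sort hH.eigenvalues
  have hs : sortedEigenvalues A = hH.eigenvalues ∘ σ := by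
    refine sortedEigenvalues_eq_of_charpoly (Tuple.monotone_sort _) ?_
    rw [hH.charpoly_eq]
    simp only [Function.comp]
    exact (Equiv.prod_comp σ fun i => (X - C (hH.eigenvalues i) : ℝ[X])).symm
  refine ⟨O₁.submatrix id σ, ?_, ?_⟩
  · have : (O₁.submatrix id σ)ᵀ * O₁.submatrix id σ = (O₁ᵀ * O₁).submatrix σ σ := by
      ext i j; simp [Matrix.mul_apply]
    rw [this, hO₁]
    exact Matrix.submatrix_one_equiv σ
  · have : (O₁.submatrix id σ)ᵀ * A * O₁.submatrix id σ = (O₁ᵀ * A * O₁).submatrix σ σ := by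
      ext i j; simp [Matrix.mul_apply]
    rw [this, hd, hs]
    ext i j
    simp [Matrix.diagonal_apply]

theorem charpoly_splits_of_symm {A : Matrix (Fin m) (Fin m) ℝ} (hA : Aᵀ = A) :
    A.charpoly.Splits :=
  Matrix.IsHermitian.splits_charpoly (by
    rw [Matrix.IsHermitian, Matrix.conjTranspose_eq_transpose_of_trivial, hA])

theorem exists_whitening {W : Matrix (Fin m) (Fin m) ℝ} (hW : W.PosDef) :
    ∃ U : Matrix (Fin m) (Fin m) ℝ, Uᵀ * W * U = 1 ∧ U * Uᵀ = W⁻¹ := by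
  have hWt : Wᵀ = W := by
    have := hW.1; rwa [Matrix.IsHermitian, Matrix.conjTranspose_eq_transpose_of_trivial] at this
  obtain ⟨O, hO, hd⟩ := exists_orthogonal_diagonal_sortedEigenvalues hWt
  have hpos : ∀ i, 0 < sortedEigenvalues W i := by
    intro i
    have h1 : sortedEigenvalues W i = (O.col i) ⬝ᵥ (W *ᵥ (O.col i)) := by
      have := congrFun (congrFun hd i) i
      rw [Matrix.diagonal_apply_eq] at this
      rw [← this, Matrix.mul_assoc, Matrix.mul_apply]
      simp [dotProduct, Matrix.mulVec, Matrix.mul_apply]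
    rw [h1]
    have := hW.dotProduct_mulVec_pos (x := O.col i) ?_
    · simpa using this
    · intro h0
      have := congrFun (congrFun hO i) i
      rw [Matrix.mul_apply] at this
      simp only [Matrix.transpose_apply, Matrix.one_apply_eq] at this
      have hz : ∀ j, O j i = 0 := fun j => congrFun h0 j
      simp [hz] at this
  set s : Fin m → ℝ := fun i => (Real.sqrt (sortedEigenvalues W i))⁻¹
  have h1 : (O * Matrix.diagonal s)ᵀ * W * (O * Matrix.diagonal s) = 1 := by
    have : (O * Matrix.diagonal s)ᵀ * W * (O * Matrix.diagonal s) =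
        Matrix.diagonal s * (Oᵀ * W * O) * Matrix.diagonal s := by
      simp only [Matrix.transpose_mul, Matrix.diagonal_transpose, Matrix.mul_assoc]
    rw [this, hd, Matrix.diagonal_mul_diagonal, Matrix.diagonal_mul_diagonal, ← Matrix.diagonal_one]
    congr 1
    funext i
    have := hpos i
    have h2 : Real.sqrt (sortedEigenvalues W i) ≠ 0 := (Real.sqrt_pos.2 this).ne'
    have h3 := Real.mul_self_sqrt this.le
    simp only [s]
    field_simp
    nlinarith [h3]
  refine ⟨_, h1, ?_⟩
  symm
  apply Matrix.inv_eq_left_inv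
  rw [Matrix.mul_assoc]
  exact mul_eq_one_comm.1 h1

/-- `W⁻¹ A` is not symmetric in general, but by cyclicity it shares its characteristic polynomial
with a congruence of `A`, which is symmetric when `A` is. Real spectra come from here. -/
theorem charpoly_inv_mul_eq {W A U : Matrix (Fin m) (Fin m) ℝ} (hU : U * Uᵀ = W⁻¹) :
    (W⁻¹ * A).charpoly = (Uᵀ * A * U).charpoly := by
  rw [← hU, Matrix.mul_assoc, Matrix.charpoly_mul_comm]

theorem charpoly_inv_mul_splits {W A : Matrix (Fin m) (Fin m) ℝ} (hW : W.PosDef) (hA : Aᵀ = A) :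
    (W⁻¹ * A).charpoly.Splits := by
  obtain ⟨U, -, hU⟩ := exists_whitening hW
  rw [charpoly_inv_mul_eq hU]
  apply charpoly_splits_of_symm
  simp only [Matrix.transpose_mul, Matrix.transpose_transpose, hA, Matrix.mul_assoc]

theorem sortedEigenvalues_congr {A B : Matrix (Fin m) (Fin m) ℝ} (h : A.charpoly = B.charpoly) :
    sortedEigenvalues A = sortedEigenvalues B := by
  funext i
  unfold sortedEigenvalues
  rw [h]

theorem exists_simultaneous_diagonalization {W A : Matrix (Fin m) (Fin m) ℝ} (hW : W.PosDef)
    (hA : Aᵀ = A) : ∃ U : Matrix (Fin m) (Fin m) ℝ, Uᵀ * W * U = 1 ∧ U * Uᵀ = W⁻¹ ∧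
      Uᵀ * A * U = Matrix.diagonal (sortedEigenvalues (W⁻¹ * A)) := by
  obtain ⟨U, h1, h2⟩ := exists_whitening hW
  have hs : (Uᵀ * A * U)ᵀ = Uᵀ * A * U := by
    simp only [Matrix.transpose_mul, Matrix.transpose_transpose, hA, Matrix.mul_assoc]
  obtain ⟨O, hO, hd⟩ := exists_orthogonal_diagonal_sortedEigenvalues hs
  refine ⟨U * O, ?_, ?_, ?_⟩
  · calc _ = Oᵀ * (Uᵀ * W * U) * O := by simp only [Matrix.transpose_mul, Matrix.mul_assoc]
      _ = 1 := by rw [h1, Matrix.mul_one, hO]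
  · calc _ = U * (O * Oᵀ) * Uᵀ := by simp only [Matrix.transpose_mul, Matrix.mul_assoc]
      _ = _ := by rw [mul_eq_one_comm.1 hO, Matrix.mul_one, h2]
  · rw [sortedEigenvalues_congr (charpoly_inv_mul_eq h2), ← hd]
    simp only [Matrix.transpose_mul, Matrix.mul_assoc]

theorem sortedEigenvalues_inv_mul_nonneg {W A : Matrix (Fin m) (Fin m) ℝ} (hW : W.PosDef)
    (hA : Aᵀ = A) (hpos : ∀ v, 0 ≤ v ⬝ᵥ (A *ᵥ v)) (i : Fin m) :
    0 ≤ sortedEigenvalues (W⁻¹ * A) i := by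
  obtain ⟨U, -, -, h⟩ := exists_simultaneous_diagonalization hW hA
  have := congrFun (congrFun h i) i
  rw [Matrix.diagonal_apply_eq] at this
  rw [← this]
  have h2 := hpos (U.col i)
  convert h2 using 1
  rw [Matrix.mul_assoc, Matrix.mul_apply]
  simp [dotProduct, Matrix.mulVec, Matrix.mul_apply]

end SortedEigenvalues

/-! ### Rayleigh quotients for a pair of forms -/

section Rayleigh

variable {m : ℕ} {W A : Matrix (Fin (m + 1)) (Fin (m + 1)) ℝ}

theorem dotProduct_congr_mulVec {a b : Type*} [Fintype a] [Fintype b]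
    (A : Matrix a a ℝ) (U : Matrix a b ℝ) (w : b → ℝ) :
    (U *ᵥ w) ⬝ᵥ (A *ᵥ (U *ᵥ w)) = w ⬝ᵥ ((Uᵀ * A * U) *ᵥ w) := by
  rw [← Matrix.mulVec_mulVec, ← Matrix.mulVec_mulVec]
  rw [Matrix.dotProduct_mulVec w, Matrix.vecMul_transpose]

theorem sortedEigenvalues_zero_mul_le (hW : W.PosDef) (hA : Aᵀ = A) (v : Fin (m + 1) → ℝ) :
    sortedEigenvalues (W⁻¹ * A) 0 * (v ⬝ᵥ (W *ᵥ v)) ≤ v ⬝ᵥ (A *ᵥ v) := by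
  obtain ⟨U, h1, h2, h3⟩ := exists_simultaneous_diagonalization hW hA
  have hmono := (sortedEigenvalues_spec (charpoly_inv_mul_splits hW hA)).1
  obtain ⟨w, rfl⟩ : ∃ w, v = U *ᵥ w := by
    refine ⟨(Uᵀ * W) *ᵥ v, ?_⟩
    rw [Matrix.mulVec_mulVec, mul_eq_one_comm.1 h1, Matrix.one_mulVec]
  rw [dotProduct_congr_mulVec, dotProduct_congr_mulVec, h1, h3]
  simp only [Matrix.one_mulVec, dotProduct, Matrix.mulVec_diagonal, Finset.mul_sum]
  refine Finset.sum_le_sum fun i _ => ?_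
  nlinarith [hmono (Fin.zero_le i), mul_self_nonneg (w i),
    mul_le_mul_of_nonneg_right (hmono (Fin.zero_le i)) (mul_self_nonneg (w i))]

/-- Scaling extends the inequality from the slice to all `v` with `v 0 ≠ 0`, and continuity along `v
+ t e₀` to the hyperplane `v 0 = 0`. An eigenvector for the least eigenvalue may lie in that
hyperplane, so the infimum over the slice need not be attained. -/
theorem le_sortedEigenvalues_zero (hW : W.PosDef) (hA : Aᵀ = A) {c : ℝ}
    (hc : ∀ v : Fin (m + 1) → ℝ, v 0 = 1 → c * (v ⬝ᵥ (W *ᵥ v)) ≤ v ⬝ᵥ (A *ᵥ v)) :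
    c ≤ sortedEigenvalues (W⁻¹ * A) 0 := by
  have hne : ∀ v : Fin (m + 1) → ℝ, v 0 ≠ 0 → c * (v ⬝ᵥ (W *ᵥ v)) ≤ v ⬝ᵥ (A *ᵥ v) := by
    intro v hv
    have := hc ((v 0)⁻¹ • v) (by simp [hv])
    simp only [Matrix.mulVec_smul, dotProduct_smul, smul_dotProduct, smul_eq_mul] at this
    rw [mul_left_comm, mul_left_comm c] at this
    rw [← mul_assoc, ← mul_assoc (v 0)⁻¹ (v 0)⁻¹] at this
    refine le_of_mul_le_mul_left this ?_
    exact mul_self_pos.2 (inv_ne_zero hv)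
  have hall : ∀ v : Fin (m + 1) → ℝ, c * (v ⬝ᵥ (W *ᵥ v)) ≤ v ⬝ᵥ (A *ᵥ v) := by
    intro v
    by_cases hv : v 0 = 0
    · have hlim : ∀ B : Matrix (Fin (m + 1)) (Fin (m + 1)) ℝ,
          Tendsto (fun t : ℝ => (v + t • Pi.single 0 1) ⬝ᵥ (B *ᵥ (v + t • Pi.single 0 1)))
          (𝓝[≠] 0) (𝓝 (v ⬝ᵥ (B *ᵥ v))) := by
        intro B
        refine Tendsto.mono_left ?_ nhdsWithin_le_nhds
        have : Continuous (fun t : ℝ => (v + t • (Pi.single 0 1 : Fin (m + 1) → ℝ)) ⬝ᵥ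
          (B *ᵥ (v + t • Pi.single 0 1))) := by fun_prop
        simpa using this.tendsto 0
      refine le_of_tendsto_of_tendsto ((hlim W).const_mul c) (hlim A) ?_
      filter_upwards [self_mem_nhdsWithin] with t ht
      exact hne _ (by simpa [hv] using ht)
    · exact hne v hv
  obtain ⟨U, h1, h2, h3⟩ := exists_simultaneous_diagonalization hW hA
  have := hall (U *ᵥ Pi.single 0 1)
  rw [dotProduct_congr_mulVec, dotProduct_congr_mulVec, h1, h3] at this
  simpa using this

end Rayleigh

/-! ### Arrow matrices and the limit polynomial -/

section Arrow

variable {m : ℕ}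

/-- The symmetric matrix with corner entry `s`, border `a` and remaining block `diagonal d`. -/
noncomputable def arrowMatrix (s : ℝ) (a d : Fin m → ℝ) : Matrix (Fin (m + 1)) (Fin (m + 1)) ℝ :=
  Matrix.of (Fin.cons (Fin.cons s a) fun i => Fin.cons (a i) (Matrix.diagonal d i))

@[simp] theorem arrowMatrix_zero_zero (s : ℝ) (a d : Fin m → ℝ) : arrowMatrix s a d 0 0 = s := rfl

@[simp] theorem arrowMatrix_zero_succ (s : ℝ) (a d : Fin m → ℝ) (j : Fin m) :
    arrowMatrix s a d 0 j.succ = a j := rfl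

@[simp] theorem arrowMatrix_succ_zero (s : ℝ) (a d : Fin m → ℝ) (i : Fin m) :
    arrowMatrix s a d i.succ 0 = a i := rfl

@[simp] theorem arrowMatrix_succ_succ (s : ℝ) (a d : Fin m → ℝ) (i j : Fin m) :
    arrowMatrix s a d i.succ j.succ = Matrix.diagonal d i j := rfl

theorem arrowMatrix_transpose (s : ℝ) (a d : Fin m → ℝ) :
    (arrowMatrix s a d)ᵀ = arrowMatrix s a d := by
  ext i j
  refine Fin.cases ?_ (fun i => ?_) i <;> refine Fin.cases ?_ (fun j => ?_) j <;>
    simp [Matrix.diagonal_apply, eq_comm]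
  split_ifs with h <;> simp [h]

/-- Column elimination: multiplying on the right by the unit lower triangular `L` clears the first
column below the corner. -/
theorem det_arrowMatrix {s : ℝ} {a d : Fin m → ℝ} (hd : ∀ i, d i ≠ 0) :
    (arrowMatrix s a d).det = (s - ∑ i, a i ^ 2 / d i) * ∏ i, d i := by
  set L : Matrix (Fin (m + 1)) (Fin (m + 1)) ℝ :=
    Matrix.of (Fin.cons (Fin.cons 1 0) fun i =>
      Fin.cons (-(a i / d i)) ((1 : Matrix (Fin m) (Fin m) ℝ) i))
    with hL
  have hL00 : L 0 0 = 1 := rfl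
  have hL0s : ∀ j : Fin m, L 0 j.succ = 0 := fun j => rfl
  have hLs0 : ∀ j : Fin m, L j.succ 0 = -(a j / d j) := fun j => rfl
  have hLss : ∀ i j : Fin m, L i.succ j.succ = (1 : Matrix (Fin m) (Fin m) ℝ) i j := fun i j => rfl
  have hdetL : L.det = 1 := by
    rw [Matrix.det_succ_row_zero, Fin.sum_univ_succ]
    simp only [hL0s, mul_zero, zero_mul, Finset.sum_const_zero, add_zero, hL00]
    have : L.submatrix Fin.succ Fin.succ = 1 := by
      ext i j; simp [hLss]
    simp [this]
  have hdet : (arrowMatrix s a d * L).det = (s - ∑ i, a i ^ 2 / d i) * ∏ i, d i := by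
    rw [Matrix.det_succ_column_zero, Fin.sum_univ_succ]
    have h0 : (arrowMatrix s a d * L) 0 0 = s - ∑ i, a i ^ 2 / d i := by
      rw [Matrix.mul_apply, Fin.sum_univ_succ]
      simp only [arrowMatrix_zero_zero, hL00, mul_one, arrowMatrix_zero_succ, hLs0, mul_neg,
        Finset.sum_neg_distrib, sub_eq_add_neg]
      congr 2
      refine Finset.sum_congr rfl fun i _ => by ring
    have hs : ∀ i : Fin m, (arrowMatrix s a d * L) i.succ 0 = 0 := by
      intro i
      rw [Matrix.mul_apply, Fin.sum_univ_succ]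
      simp only [arrowMatrix_succ_zero, hL00, mul_one, arrowMatrix_succ_succ, hLs0,
        Matrix.diagonal_apply, ite_mul, zero_mul, Finset.sum_ite_eq, Finset.mem_univ, if_true]
      have := hd i
      field_simp
      ring
    have hblock : (arrowMatrix s a d * L).submatrix Fin.succ Fin.succ =
        Matrix.diagonal d := by
      ext i j
      simp only [Matrix.submatrix_apply, Matrix.mul_apply, Fin.sum_univ_succ,
        hL0s, mul_zero, zero_add, arrowMatrix_succ_succ, hLss]
      rw [← Matrix.mul_apply, Matrix.mul_one]
    simp [h0, hs, hblock]
  rw [← hdet, Matrix.det_mul, hdetL, mul_one]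

theorem charpoly_arrowMatrix (s : ℝ) (a d : Fin m → ℝ) :
    (arrowMatrix s a d).charpoly = (X - C s) * ∏ i, (X - C (d i))
      - ∑ i : Fin m, C (a i ^ 2) * ∏ j ∈ Finset.univ.erase i, (X - C (d j)) := by
  -- The elimination divides by `x - d i`, so the values are compared only off the finite range of
  -- `d`, which suffices for polynomials.
  refine Polynomial.eq_of_infinite_eval_eq _ _ (Set.Infinite.mono (s := (Set.range d)ᶜ) ?_
    (Set.Finite.infinite_compl (Set.finite_range d)))
  intro x hx
  have hne : ∀ i, x - d i ≠ 0 := fun i h => hx ⟨i, by linarith⟩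
  show Polynomial.eval x _ = Polynomial.eval x _
  rw [Matrix.eval_charpoly]
  have : Matrix.scalar (Fin (m + 1)) x - arrowMatrix s a d =
      arrowMatrix (x - s) (-a) (fun i => x - d i) := by
    ext i j
    refine Fin.cases ?_ (fun i => ?_) i <;> refine Fin.cases ?_ (fun j => ?_) j <;>
      simp [Matrix.diagonal_apply]
    · exact fun h => absurd h (Fin.succ_ne_zero _).symm
    · split_ifs <;> simp
  rw [this, det_arrowMatrix hne]
  simp only [eval_sub, eval_mul, eval_X, eval_C, eval_prod, eval_finsetSum, Pi.neg_apply,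
    sub_mul (x - s), Finset.sum_mul]
  congr 1
  refine Finset.sum_congr rfl fun i _ => ?_
  rw [← Finset.mul_prod_erase _ _ (Finset.mem_univ i)]
  have := hne i
  field_simp

/-- Only the squares of the border enter. Its signs are free, which matters later because the border
is `√λⱼ ⟨bⱼ, ξ⟩`. -/
theorem charpoly_arrowMatrix_eq_limitPoly {lam : Fin m → ℝ} {q : Fin (m + 1) → ℝ}
    {a : Fin m → ℝ} (ha : ∀ i, a i ^ 2 = lam i * q i.succ) :
    (arrowMatrix (∑ i, q i) a lam).charpoly = limitPoly lam q := by
  rw [charpoly_arrowMatrix, limitPoly]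
  simp only [ha]

theorem isLeast_sortedEigenvalues_zero {A : Matrix (Fin (m + 1)) (Fin (m + 1)) ℝ}
    (h : A.charpoly.Splits) : IsLeast {x : ℝ | A.charpoly.IsRoot x} (sortedEigenvalues A 0) := by
  refine ⟨sortedEigenvalues_isRoot h 0, fun x hx => ?_⟩
  have hx' : A.charpoly.eval x = 0 := hx
  rw [(sortedEigenvalues_spec h).2, eval_prod, Finset.prod_eq_zero_iff] at hx'
  obtain ⟨i, -, hi⟩ := hx'
  simp only [eval_sub, eval_X, eval_C] at hi
  have := (sortedEigenvalues_spec h).1 (Fin.zero_le i)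
  linarith

theorem isLeast_muMin {A : Matrix (Fin (m + 1)) (Fin (m + 1)) ℝ} {lam : Fin m → ℝ}
    {q : Fin (m + 1) → ℝ} (h : A.charpoly.Splits) (hA : A.charpoly = limitPoly lam q) :
    IsLeast {x : ℝ | (limitPoly lam q).IsRoot x} (muMin lam q) ∧
      muMin lam q = sortedEigenvalues A 0 := by
  have := isLeast_sortedEigenvalues_zero h
  rw [hA] at this
  have h2 : muMin lam q = sortedEigenvalues A 0 := this.csInf_eq
  exact ⟨h2 ▸ this, h2⟩

/-- The arrow matrix with characteristic polynomial `limitPoly lam q`. -/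
noncomputable def limitMatrix (lam : Fin m → ℝ) (q : Fin (m + 1) → ℝ) :
    Matrix (Fin (m + 1)) (Fin (m + 1)) ℝ :=
  arrowMatrix (∑ i, q i) (fun i => Real.sqrt (lam i * q i.succ)) lam

theorem charpoly_limitMatrix {lam : Fin m → ℝ} {q : Fin (m + 1) → ℝ}
    (hlam : ∀ i, 0 ≤ lam i) (hq : ∀ i, 0 ≤ q i) :
    (limitMatrix lam q).charpoly = limitPoly lam q :=
  charpoly_arrowMatrix_eq_limitPoly fun i => Real.sq_sqrt (mul_nonneg (hlam i) (hq _))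

theorem limitMatrix_transpose (lam : Fin m → ℝ) (q : Fin (m + 1) → ℝ) :
    (limitMatrix lam q)ᵀ = limitMatrix lam q := arrowMatrix_transpose _ _ _

theorem limitMatrix_charpoly_splits (lam : Fin m → ℝ) (q : Fin (m + 1) → ℝ) :
    (limitMatrix lam q).charpoly.Splits := charpoly_splits_of_symm (limitMatrix_transpose _ _)

theorem dotProduct_arrowMatrix_mulVec (s : ℝ) (a d : Fin m → ℝ) (v : Fin (m + 1) → ℝ) :
    v ⬝ᵥ (arrowMatrix s a d *ᵥ v) = s * v 0 ^ 2 + ∑ i : Fin m,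
      (2 * a i * v 0 * v i.succ + d i * v i.succ ^ 2) := by
  have h : ∀ i : Fin m, ∑ j : Fin m, Matrix.diagonal d i j * v j.succ = d i * v i.succ := by
    intro i
    simp [Matrix.diagonal_apply]
  simp only [dotProduct, Matrix.mulVec, Fin.sum_univ_succ, arrowMatrix_zero_zero,
    arrowMatrix_zero_succ, arrowMatrix_succ_zero, arrowMatrix_succ_succ, h]
  rw [mul_add, add_assoc, Finset.mul_sum, ← Finset.sum_add_distrib]
  congr 1
  · ring
  · exact Finset.sum_congr rfl fun i _ => by ring

/-- Completing squares makes the form visibly nonnegative, and suggests the test vectors that bound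
the least eigenvalue. -/
theorem dotProduct_limitMatrix_mulVec {lam : Fin m → ℝ} {q : Fin (m + 1) → ℝ}
    (hlam : ∀ i, 0 ≤ lam i) (hq : ∀ i, 0 ≤ q i) (v : Fin (m + 1) → ℝ) :
    v ⬝ᵥ (limitMatrix lam q *ᵥ v) = q 0 * v 0 ^ 2 + ∑ i : Fin m,
      (Real.sqrt (q i.succ) * v 0 + Real.sqrt (lam i) * v i.succ) ^ 2 := by
  rw [limitMatrix, dotProduct_arrowMatrix_mulVec, Fin.sum_univ_succ, add_mul, Finset.sum_mul,
    add_assoc, ← Finset.sum_add_distrib]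
  congr 1
  refine Finset.sum_congr rfl fun i _ => ?_
  rw [Real.sqrt_mul (hlam i)]
  linear_combination (-(v 0 ^ 2)) * Real.sq_sqrt (hq i.succ) - (v i.succ ^ 2) * Real.sq_sqrt (hlam i)

theorem muMin_mul_le {lam : Fin m → ℝ} {q : Fin (m + 1) → ℝ}
    (hlam : ∀ i, 0 ≤ lam i) (hq : ∀ i, 0 ≤ q i) (v : Fin (m + 1) → ℝ) :
    muMin lam q * (v ⬝ᵥ v) ≤ q 0 * v 0 ^ 2 + ∑ i : Fin m,
      (Real.sqrt (q i.succ) * v 0 + Real.sqrt (lam i) * v i.succ) ^ 2 := by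
  have := sortedEigenvalues_zero_mul_le Matrix.PosDef.one (limitMatrix_transpose lam q) v
  rw [dotProduct_limitMatrix_mulVec hlam hq] at this
  rw [(isLeast_muMin (limitMatrix_charpoly_splits lam q) (charpoly_limitMatrix hlam hq)).2]
  simpa using this

theorem muMin_nonneg {lam : Fin m → ℝ} {q : Fin (m + 1) → ℝ}
    (hlam : ∀ i, 0 ≤ lam i) (hq : ∀ i, 0 ≤ q i) : 0 ≤ muMin lam q := by
  rw [(isLeast_muMin (limitMatrix_charpoly_splits lam q) (charpoly_limitMatrix hlam hq)).2]
  have := sortedEigenvalues_inv_mul_nonneg Matrix.PosDef.one (limitMatrix_transpose lam q)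
    (fun v => by
      rw [dotProduct_limitMatrix_mulVec hlam hq]
      have := hq 0
      positivity) 0
  simpa using this

theorem muMin_le_lam {lam : Fin m → ℝ} {q : Fin (m + 1) → ℝ}
    (hlam : ∀ i, 0 ≤ lam i) (hq : ∀ i, 0 ≤ q i) (i : Fin m) : muMin lam q ≤ lam i := by
  have := muMin_mul_le hlam hq (Pi.single i.succ 1)
  simpa [Pi.single_apply, (Fin.succ_ne_zero _).symm, Real.sq_sqrt (hlam i),
    Fin.succ_inj, ite_pow] using this

theorem muMin_le_q_zero {lam : Fin m → ℝ} {q : Fin (m + 1) → ℝ}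
    (hlam : ∀ i, 0 ≤ lam i) (hq : ∀ i, 0 ≤ q i) : muMin lam q ≤ q 0 := by
  by_cases h : ∃ i, lam i = 0
  · obtain ⟨i, hi⟩ := h
    exact (muMin_le_lam hlam hq i).trans (hi ▸ hq 0)
  · push Not at h
    have hpos : ∀ i, Real.sqrt (lam i) ≠ 0 := fun i =>
      (Real.sqrt_pos.2 (lt_of_le_of_ne (hlam i) (h i).symm)).ne'
    -- This vector annihilates every square and leaves `q 0` on the right. Its squared length is at
    -- least one, so nonnegativity of `muMin` finishes the argument.
    have := muMin_mul_le hlam hq (Fin.cons 1 fun i => -(Real.sqrt (q i.succ) / Real.sqrt (lam i)))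
    have h2 : ∀ i : Fin m, Real.sqrt (lam i) * (Real.sqrt (q i.succ) / Real.sqrt (lam i)) =
      Real.sqrt (q i.succ) := fun i => by have := hpos i; field_simp
    simp only [dotProduct, Fin.sum_univ_succ, Fin.cons_zero, Fin.cons_succ, mul_neg, h2, neg_neg,
      mul_one, add_neg_cancel, ne_eq, OfNat.ofNat_ne_zero, not_false_eq_true, zero_pow,
      Finset.sum_const_zero, one_pow, add_zero, neg_mul] at this
    have h3 : 0 ≤ ∑ i : Fin m, Real.sqrt (q i.succ) / Real.sqrt (lam i) *
        (Real.sqrt (q i.succ) / Real.sqrt (lam i)) :=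
      Finset.sum_nonneg fun i _ => mul_self_nonneg _
    nlinarith [muMin_nonneg hlam hq, mul_nonneg (muMin_nonneg hlam hq) h3]

/-- A continuous function of `(lam, q)` that agrees with `limitLR` at nonnegative arguments. -/
noncomputable def limitLRExt (p : (Fin m → ℝ) × (Fin (m + 1) → ℝ)) : ℝ :=
  limitLR (fun i => max (p.1 i) 0) (fun i => max (p.2 i) 0)

theorem limitLRExt_eq {lam : Fin m → ℝ} {q : Fin (m + 1) → ℝ}
    (hlam : ∀ i, 0 ≤ lam i) (hq : ∀ i, 0 ≤ q i) : limitLRExt (lam, q) = limitLR lam q := by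
  simp [limitLRExt, hlam, hq]

/-- For the truncated arguments, `muMin` is the least eigenvalue of an arrow matrix with continuous
entries. Truncating gives continuity on the whole space, as needed for measurability and for bounded
continuous test functions. -/
theorem continuous_limitLRExt : Continuous (limitLRExt (m := m)) := by
  have h : ∀ p : (Fin m → ℝ) × (Fin (m + 1) → ℝ), limitLRExt p = ∑ i, max (p.2 i) 0 -
      sortedEigenvalues (limitMatrix (fun i => max (p.1 i) 0) (fun i => max (p.2 i) 0)) 0 := by
    intro p
    rw [limitLRExt, limitLR, (isLeast_muMin (limitMatrix_charpoly_splits _ _)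
      (charpoly_limitMatrix (fun i => le_max_right _ _) (fun i => le_max_right _ _))).2]
  rw [funext h]
  refine Continuous.sub (by fun_prop) ?_
  refine continuous_pi_iff.1 (?_ : Continuous fun p : (Fin m → ℝ) × (Fin (m + 1) → ℝ) =>
    sortedEigenvalues (limitMatrix (fun i => max (p.1 i) 0) (fun i => max (p.2 i) 0))) 0
  refine continuousOn_sortedEigenvalues.comp_continuous ?_
    fun p => limitMatrix_charpoly_splits _ _
  refine continuous_matrix fun i j => ?_
  simp only [limitMatrix]
  refine Fin.cases ?_ (fun i => ?_) i <;> refine Fin.cases ?_ (fun j => ?_) j <;>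
    simp only [arrowMatrix_zero_zero, arrowMatrix_zero_succ, arrowMatrix_succ_zero,
      arrowMatrix_succ_succ, Matrix.diagonal_apply]
  · fun_prop
  · fun_prop
  · fun_prop
  · split_ifs <;> fun_prop

end Arrow

/-! ### Matrix square roots and positive forms -/

section MatSqrt

variable {k : ℕ}

theorem transpose_eq_of_isHermitian {A : Matrix (Fin k) (Fin k) ℝ} (h : A.IsHermitian) :
    Aᵀ = A := by
  rwa [Matrix.IsHermitian, Matrix.conjTranspose_eq_transpose_of_trivial] at h

theorem isHermitian_of_transpose_eq {A : Matrix (Fin k) (Fin k) ℝ} (h : Aᵀ = A) :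
    A.IsHermitian := by
  rwa [Matrix.IsHermitian, Matrix.conjTranspose_eq_transpose_of_trivial]

open scoped MatrixOrder in
theorem spectrum_nonneg_of_posSemidef {A : Matrix (Fin k) (Fin k) ℝ} (hA : A.PosSemidef) {x : ℝ}
    (hx : x ∈ spectrum ℝ A) : 0 ≤ x :=
  spectrum_nonneg_of_nonneg hA.nonneg hx

theorem spectrum_pos_of_posDef {A : Matrix (Fin k) (Fin k) ℝ} (hA : A.PosDef) {x : ℝ}
    (hx : x ∈ spectrum ℝ A) : 0 < x := by
  refine lt_of_le_of_ne (spectrum_nonneg_of_posSemidef hA.posSemidef hx) ?_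
  rintro rfl
  exact spectrum.zero_notMem ℝ hA.isUnit hx

theorem continuousOn_spectrum_matrix (A : Matrix (Fin k) (Fin k) ℝ) (f : ℝ → ℝ) :
    ContinuousOn f (spectrum ℝ A) := A.finite_real_spectrum.continuousOn f

theorem matSqrt_mul_self {A : Matrix (Fin k) (Fin k) ℝ} (hA : A.PosSemidef) :
    matSqrt A * matSqrt A = A := by
  have hs : IsSelfAdjoint A := hA.1
  rw [matSqrt, ← cfc_mul Real.sqrt Real.sqrt A (continuousOn_spectrum_matrix _ _)
    (continuousOn_spectrum_matrix _ _)]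
  conv_rhs => rw [← cfc_id ℝ A]
  exact cfc_congr fun x hx => Real.mul_self_sqrt (spectrum_nonneg_of_posSemidef hA hx)

theorem matInvSqrt_mul_matSqrt {A : Matrix (Fin k) (Fin k) ℝ} (hA : A.PosDef) :
    matInvSqrt A * matSqrt A = 1 := by
  have hs : IsSelfAdjoint A := hA.1
  rw [matSqrt, matInvSqrt, ← cfc_mul _ Real.sqrt A (continuousOn_spectrum_matrix _ _)
    (continuousOn_spectrum_matrix _ _), ← cfc_one ℝ A]
  refine cfc_congr fun x hx => ?_
  exact inv_mul_cancel₀ (Real.sqrt_pos.2 (spectrum_pos_of_posDef hA hx)).ne'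

theorem matInvSqrt_transpose (A : Matrix (Fin k) (Fin k) ℝ) : (matInvSqrt A)ᵀ = matInvSqrt A :=
  transpose_eq_of_isHermitian (cfc_predicate (p := IsSelfAdjoint) _ A)

theorem matSqrt_transpose (A : Matrix (Fin k) (Fin k) ℝ) : (matSqrt A)ᵀ = matSqrt A :=
  transpose_eq_of_isHermitian (cfc_predicate (p := IsSelfAdjoint) _ A)

open scoped MatrixOrder in
theorem matSqrt_posSemidef (A : Matrix (Fin k) (Fin k) ℝ) : (matSqrt A).PosSemidef := by
  rw [← Matrix.nonneg_iff_posSemidef]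
  exact cfc_nonneg fun x _ => Real.sqrt_nonneg x

theorem matSqrt_unique {A B : Matrix (Fin k) (Fin k) ℝ} (hB : B.PosSemidef) (h : B * B = A) :
    matSqrt A = B := by
  have hs : IsSelfAdjoint B := hB.1
  have h2 : A = cfc (fun x : ℝ => x * x) B := by
    rw [cfc_mul _ _ B (continuousOn_spectrum_matrix _ _) (continuousOn_spectrum_matrix _ _)]
    rw [← h]
    congr 1 <;> exact (cfc_id ℝ B).symm
  rw [matSqrt, h2, ← cfc_comp Real.sqrt (fun x : ℝ => x * x) B hs
    ((B.finite_real_spectrum.image _).continuousOn _) (continuousOn_spectrum_matrix _ _)]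
  conv_rhs => rw [← cfc_id ℝ B]
  exact cfc_congr fun x hx => Real.sqrt_mul_self (spectrum_nonneg_of_posSemidef hB hx)

theorem matSqrt_smul {A : Matrix (Fin k) (Fin k) ℝ} (hA : A.PosSemidef) {c : ℝ} (hc : 0 ≤ c) :
    matSqrt (c • A) = Real.sqrt c • matSqrt A := by
  refine matSqrt_unique ((matSqrt_posSemidef A).smul (Real.sqrt_nonneg c)) ?_
  rw [Matrix.smul_mul, Matrix.mul_smul, smul_smul, Real.mul_self_sqrt hc, matSqrt_mul_self hA]

theorem isClosed_posSemidef : IsClosed {A : Matrix (Fin k) (Fin k) ℝ | A.PosSemidef} := by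
  have : {A : Matrix (Fin k) (Fin k) ℝ | A.PosSemidef} =
      {A | Aᵀ = A} ∩ ⋂ v : Fin k → ℝ, {A | 0 ≤ v ⬝ᵥ (A *ᵥ v)} := by
    ext A
    simp only [Set.mem_inter_iff, Set.mem_iInter]
    refine ⟨fun h => ⟨transpose_eq_of_isHermitian h.1, fun v => ?_⟩, fun h => ?_⟩
    · simpa using h.dotProduct_mulVec_nonneg v
    · exact Matrix.PosSemidef.of_dotProduct_mulVec_nonneg (isHermitian_of_transpose_eq h.1)
        fun v => by simpa using h.2 v
  rw [this]
  refine IsClosed.inter (isClosed_eq (by fun_prop) (by fun_prop)) (isClosed_iInter fun v => ?_)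
  exact isClosed_le (by fun_prop) (by fun_prop)

/-- Compactness again: the roots of nearby matrices are bounded, and a cluster point is positive
semidefinite with square `A`, hence equal to the unique root. -/
theorem continuousOn_matSqrt :
    ContinuousOn (matSqrt (k := k)) {A | A.PosSemidef} := by
  intro A hA
  set R : ℝ := (∑ i, A i i) + 1
  have hev : ∀ᶠ B in 𝓝[{A : Matrix (Fin k) (Fin k) ℝ | A.PosSemidef}] A,
      B.PosSemidef ∧ ∑ i, B i i < R := by
    refine Filter.Eventually.and self_mem_nhdsWithin (nhdsWithin_le_nhds ?_)
    have hcont : Continuous fun B : Matrix (Fin k) (Fin k) ℝ => ∑ i, B i i := by fun_prop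
    exact hcont.continuousAt.eventually_lt continuousAt_const (by simp [R])
  have hK : IsCompact ({B : Matrix (Fin k) (Fin k) ℝ | B.PosSemidef} ∩
      Set.pi Set.univ fun _ => Set.pi Set.univ fun _ => Set.Icc (-Real.sqrt R) (Real.sqrt R)) :=
    IsCompact.inter_left (isCompact_univ_pi fun _ => isCompact_univ_pi fun _ => isCompact_Icc)
      isClosed_posSemidef
  refine hK.tendsto_nhds_of_unique_mapClusterPt ?_ ?_
  · filter_upwards [hev] with B hB
    refine ⟨matSqrt_posSemidef B, fun i _ j _ => ?_⟩
    -- The squares in row `i` of the root sum to `B i i`, which is at most the trace of `B`.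
    refine abs_le.1 (Real.abs_le_sqrt ?_)
    have h1 : ∀ i, B i i = ∑ j, matSqrt B i j ^ 2 := by
      intro i
      conv_lhs => rw [← matSqrt_mul_self hB.1, Matrix.mul_apply]
      refine Finset.sum_congr rfl fun j _ => ?_
      rw [sq]
      congr 1
      exact congrFun (congrFun (matSqrt_transpose B) i) j
    have h2 : matSqrt B i j ^ 2 ≤ B i i := by
      rw [h1]
      exact Finset.single_le_sum (f := fun j => matSqrt B i j ^ 2) (fun j _ => sq_nonneg _)
        (Finset.mem_univ j)
    have h3 : B i i ≤ ∑ i, B i i := Finset.single_le_sum (f := fun i => B i i)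
      (fun i _ => hB.1.diag_nonneg) (Finset.mem_univ i)
    linarith [hB.2]
  · rintro B ⟨hB, -⟩ hcl
    refine (matSqrt_unique hB ?_).symm
    have h1 := MapClusterPt.continuousAt_comp (f := fun B : Matrix (Fin k) (Fin k) ℝ => B * B)
      (Continuous.continuousAt (by fun_prop)) hcl
    have h2 : Tendsto ((fun B : Matrix (Fin k) (Fin k) ℝ => B * B) ∘ matSqrt)
        (𝓝[{A | A.PosSemidef}] A) (𝓝 A) := by
      refine (tendsto_id.mono_left nhdsWithin_le_nhds).congr' ?_
      filter_upwards [self_mem_nhdsWithin] with B hB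
      exact (matSqrt_mul_self hB).symm
    exact eq_of_nhds_neBot (ClusterPt.mono h1 h2)

/-- The matrices whose quadratic form is positive away from the origin. -/
def positiveForms (k : ℕ) : Set (Matrix (Fin k) (Fin k) ℝ) :=
  {A | ∀ v : Fin k → ℝ, v ≠ 0 → 0 < v ⬝ᵥ (A *ᵥ v)}

/-- Positivity on the compact unit sphere persists under small perturbations, and homogeneity
extends it to all nonzero vectors. -/
theorem isOpen_positiveForms : IsOpen (positiveForms k) := by
  rw [isOpen_iff_eventually]
  intro A hA
  have h : ∀ᶠ B in 𝓝 A, ∀ v ∈ Metric.sphere (0 : Fin k → ℝ) 1, 0 < v ⬝ᵥ (B *ᵥ v) := by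
    refine (isCompact_sphere _ _).eventually_forall_of_forall_eventually fun v hv => ?_
    have hc : Continuous fun z : Matrix (Fin k) (Fin k) ℝ × (Fin k → ℝ) =>
        z.2 ⬝ᵥ (z.1 *ᵥ z.2) := by fun_prop
    refine hc.continuousAt.eventually_const_lt (hA v ?_)
    rintro rfl
    simp at hv
  filter_upwards [h] with B hB v hv
  have hn : 0 < ‖v‖ := norm_pos_iff.2 hv
  have := hB (‖v‖⁻¹ • v) (by simp [norm_smul, hn.ne'])
  simp only [Matrix.mulVec_smul, dotProduct_smul, smul_dotProduct, smul_eq_mul] at this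
  rw [← mul_assoc] at this
  exact (mul_pos_iff_of_pos_left (by positivity)).1 this

/-- Positive definiteness is split into an open condition and a linear one because it includes
symmetry, and so need not be open among all matrices. The two halves play different roles in the
continuous mapping theorem. -/
theorem posDef_iff_mem_positiveForms {A : Matrix (Fin k) (Fin k) ℝ} :
    A.PosDef ↔ Aᵀ = A ∧ A ∈ positiveForms k := by
  rw [Matrix.posDef_iff_dotProduct_mulVec]
  constructor
  · exact fun h => ⟨transpose_eq_of_isHermitian h.1, fun v hv => by simpa using h.2 hv⟩
  · exact fun h => ⟨isHermitian_of_transpose_eq h.1, fun v hv => by simpa using h.2 v hv⟩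

end MatSqrt

/-! ### Schur complements and the statistics as functions of `(S, W)` -/

section Schur

variable {m k : ℕ}

/-- The block column `(-W_{0,V} / W_{00} ; 1)`. -/
noncomputable def schurMatrix (W : Matrix (Fin (m + 1)) (Fin (m + 1)) ℝ) :
    Matrix (Fin (m + 1)) (Fin m) ℝ :=
  Matrix.of (Fin.cons (fun j => -(W 0 j.succ / W 0 0)) (1 : Matrix (Fin m) (Fin m) ℝ))

@[simp] theorem schurMatrix_zero (W : Matrix (Fin (m + 1)) (Fin (m + 1)) ℝ) (j : Fin m) :
    schurMatrix W 0 j = -(W 0 j.succ / W 0 0) := rfl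

@[simp] theorem schurMatrix_succ (W : Matrix (Fin (m + 1)) (Fin (m + 1)) ℝ) (i j : Fin m) :
    schurMatrix W i.succ j = (1 : Matrix (Fin m) (Fin m) ℝ) i j := rfl

theorem mul_schurMatrix_apply {a : Type*} (S : Matrix a (Fin (m + 1)) ℝ)
    (W : Matrix (Fin (m + 1)) (Fin (m + 1)) ℝ) (i : a) (j : Fin m) :
    (S * schurMatrix W) i j = S i j.succ - S i 0 * (W 0 j.succ / W 0 0) := by
  rw [Matrix.mul_apply, Fin.sum_univ_succ]
  simp [Matrix.one_apply]
  ring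

/-- The columns of `schurMatrix W` are `W`-orthogonal to the first coordinate vector; they are the
regression residuals on that coordinate. -/
theorem mul_schurMatrix_zero {W : Matrix (Fin (m + 1)) (Fin (m + 1)) ℝ} (h : W 0 0 ≠ 0)
    (j : Fin m) : (W * schurMatrix W) 0 j = 0 := by
  rw [mul_schurMatrix_apply]
  field_simp
  ring

theorem condCov_eq {W : Matrix (Fin (m + 1)) (Fin (m + 1)) ℝ} (h : W 0 0 ≠ 0) :
    condCov W = (schurMatrix W)ᵀ * W * schurMatrix W := by
  ext i j
  rw [Matrix.mul_assoc, Matrix.mul_apply, Fin.sum_univ_succ, mul_schurMatrix_zero h]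
  simp only [Matrix.transpose_apply, schurMatrix_succ, mul_zero, zero_add, Matrix.one_apply,
    ite_mul, one_mul, zero_mul, Finset.sum_ite_eq', Finset.mem_univ, if_true]
  rw [mul_schurMatrix_apply, condCov, Matrix.of_apply]
  ring

theorem condCov_posDef {W : Matrix (Fin (m + 1)) (Fin (m + 1)) ℝ} (h : W.PosDef) :
    (condCov W).PosDef := by
  rw [condCov_eq h.diag_pos.ne', ← Matrix.conjTranspose_eq_transpose_of_trivial]
  refine h.conjTranspose_mul_mul_same fun v w hvw => ?_
  funext i
  have := congrFun hvw i.succ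
  simpa [Matrix.mulVec, dotProduct, Matrix.one_apply] using this

/-- The limiting eigenvalue statistic as a function of the normalised moments. -/
noncomputable def momentLambdas (S : Matrix (Fin k) (Fin (m + 1)) ℝ)
    (W : Matrix (Fin (m + 1)) (Fin (m + 1)) ℝ) : Fin m → ℝ :=
  sortedEigenvalues ((condCov W)⁻¹ * ((S * schurMatrix W)ᵀ * (S * schurMatrix W)))

/-- The likelihood ratio as a function of the normalised moments. -/
noncomputable def momentLR (S : Matrix (Fin k) (Fin (m + 1)) ℝ)
    (W : Matrix (Fin (m + 1)) (Fin (m + 1)) ℝ) : ℝ :=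
  (Sᵀ * S) 0 0 / W 0 0 - sortedEigenvalues (W⁻¹ * (Sᵀ * S)) 0

theorem gram_transpose {a b : Type*} [Fintype a] (S : Matrix a b ℝ) : (Sᵀ * S)ᵀ = Sᵀ * S := by
  rw [Matrix.transpose_mul, Matrix.transpose_transpose]

theorem gram_quadratic {a b : Type*} [Fintype a] [Fintype b] (S : Matrix a b ℝ) (v : b → ℝ) :
    v ⬝ᵥ ((Sᵀ * S) *ᵥ v) = (S *ᵥ v) ⬝ᵥ (S *ᵥ v) := by
  rw [← Matrix.mulVec_mulVec, Matrix.dotProduct_mulVec, Matrix.vecMul_transpose]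

theorem gram_quadratic_nonneg {a b : Type*} [Fintype a] [Fintype b] (S : Matrix a b ℝ)
    (v : b → ℝ) : 0 ≤ v ⬝ᵥ ((Sᵀ * S) *ᵥ v) := by
  rw [gram_quadratic]
  exact Finset.sum_nonneg fun i _ => mul_self_nonneg _

theorem continuousOn_inv_matrix {a : ℕ} :
    ContinuousOn (fun A : Matrix (Fin a) (Fin a) ℝ => A⁻¹) {A | A.det ≠ 0} := by
  intro A hA
  simp only [Matrix.inv_def, Ring.inverse_eq_inv']
  refine ContinuousAt.continuousWithinAt (ContinuousAt.smul (ContinuousAt.inv₀ ?_ hA) ?_)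
  · exact Continuous.continuousAt (by fun_prop)
  · exact Continuous.continuousAt (by fun_prop)

theorem continuousOn_matrix_mul {T a b c : Type*} [TopologicalSpace T] [Fintype b]
    {f : T → Matrix a b ℝ} {g : T → Matrix b c ℝ} {s : Set T} (hf : ContinuousOn f s)
    (hg : ContinuousOn g s) : ContinuousOn (fun x => f x * g x) s :=
  (continuous_fst.matrix_mul continuous_snd).comp_continuousOn (hf.prodMk hg)

theorem continuousOn_momentLambdas :
    ContinuousOn (fun p : Matrix (Fin k) (Fin (m + 1)) ℝ × Matrix (Fin (m + 1)) (Fin (m + 1)) ℝ =>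
      momentLambdas p.1 p.2) {p | p.2.PosDef} := by
  have hT : ContinuousOn (fun p : Matrix (Fin k) (Fin (m + 1)) ℝ ×
      Matrix (Fin (m + 1)) (Fin (m + 1)) ℝ => schurMatrix p.2) {p | p.2.PosDef} := by
    refine continuousOn_pi.2 fun i => continuousOn_pi.2 fun j => ?_
    refine Fin.cases ?_ (fun i => ?_) i
    · simp only [schurMatrix_zero]
      refine ContinuousOn.neg (ContinuousOn.div (by fun_prop) (by fun_prop) fun p hp => ?_)
      exact (Matrix.PosDef.diag_pos hp).ne'
    · simp only [schurMatrix_succ]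
      fun_prop
  have hST := continuousOn_matrix_mul continuousOn_fst hT
  have hC : ContinuousOn (fun p : Matrix (Fin k) (Fin (m + 1)) ℝ ×
      Matrix (Fin (m + 1)) (Fin (m + 1)) ℝ => condCov p.2) {p | p.2.PosDef} := by
    refine continuousOn_pi.2 fun i => continuousOn_pi.2 fun j => ?_
    simp only [condCov, Matrix.of_apply]
    refine ContinuousOn.sub (by fun_prop)
      (ContinuousOn.div (by fun_prop) (by fun_prop) fun p hp => ?_)
    exact (Matrix.PosDef.diag_pos hp).ne'
  refine continuousOn_sortedEigenvalues.comp ?_ fun p hp =>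
    charpoly_inv_mul_splits (condCov_posDef hp) (gram_transpose _)
  refine continuousOn_matrix_mul (continuousOn_inv_matrix.comp hC
    fun p hp => (condCov_posDef hp).det_pos.ne') (continuousOn_matrix_mul ?_ hST)
  exact (Continuous.matrix_transpose continuous_id).comp_continuousOn hST

theorem continuousOn_momentLR :
    ContinuousOn (fun p : Matrix (Fin k) (Fin (m + 1)) ℝ × Matrix (Fin (m + 1)) (Fin (m + 1)) ℝ =>
      momentLR p.1 p.2) {p | p.2.PosDef} := by
  refine ContinuousOn.sub (ContinuousOn.div (by fun_prop) (by fun_prop) fun p hp =>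
    (Matrix.PosDef.diag_pos hp).ne') ?_
  refine continuousOn_pi.1 (?_ : ContinuousOn (fun p : Matrix (Fin k) (Fin (m + 1)) ℝ ×
    Matrix (Fin (m + 1)) (Fin (m + 1)) ℝ => sortedEigenvalues (p.2⁻¹ * (p.1ᵀ * p.1)))
    {p | p.2.PosDef}) 0
  refine continuousOn_sortedEigenvalues.comp ?_ fun p hp =>
    charpoly_inv_mul_splits hp (gram_transpose _)
  refine continuousOn_matrix_mul (continuousOn_inv_matrix.comp continuousOn_snd
    fun p hp => (Matrix.PosDef.det_pos hp).ne') (by fun_prop)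

/-- `momentLR` in terms of an infimum over the affine slice `v 0 = 1`. -/
theorem iInf_ratio_eq_sortedEigenvalues {W A : Matrix (Fin (m + 1)) (Fin (m + 1)) ℝ}
    (hW : W.PosDef) (hA : Aᵀ = A) {ι : Type*} [Nonempty ι] (v : ι → Fin (m + 1) → ℝ)
    (hv : Set.range v = {x | x 0 = 1}) :
    ⨅ b, (v b ⬝ᵥ (A *ᵥ v b)) / (v b ⬝ᵥ (W *ᵥ v b)) = sortedEigenvalues (W⁻¹ * A) 0 := by
  have hpos : ∀ b, 0 < v b ⬝ᵥ (W *ᵥ v b) := by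
    intro b
    have h1 : v b 0 = 1 := by
      have : v b ∈ Set.range v := ⟨b, rfl⟩
      rw [hv] at this
      exact this
    refine (posDef_iff_mem_positiveForms.1 hW).2 _ fun h => ?_
    rw [h] at h1
    simp at h1
  have hlow : ∀ b, sortedEigenvalues (W⁻¹ * A) 0 ≤
      (v b ⬝ᵥ (A *ᵥ v b)) / (v b ⬝ᵥ (W *ᵥ v b)) := fun b =>
    (le_div_iff₀ (hpos b)).2 (sortedEigenvalues_zero_mul_le hW hA _)
  refine le_antisymm ?_ (le_ciInf hlow)
  refine le_sortedEigenvalues_zero hW hA fun x hx => ?_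
  have : x ∈ Set.range v := by rw [hv]; exact hx
  obtain ⟨b, rfl⟩ := this
  exact (le_div_iff₀ (hpos b)).1 (ciInf_le ⟨_, Set.forall_mem_range.2 hlow⟩ b)

end Schur

/-! ### Exact finite-sample identities -/

section FiniteSample

variable {n k m : ℕ}

/-- The `k × (1 + m)` matrix `(0 A)`. -/
def padZero {a : Type*} (A : Matrix a (Fin m) ℝ) : Matrix a (Fin (m + 1)) ℝ :=
  Matrix.of fun i => (Fin.cons 0 (A i) : Fin (m + 1) → ℝ)

@[simp] theorem padZero_zero {a : Type*} (A : Matrix a (Fin m) ℝ) (i : a) : padZero A i 0 = 0 := rfl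

@[simp] theorem padZero_succ {a : Type*} (A : Matrix a (Fin m) ℝ) (i : a) (j : Fin m) :
    padZero A i j.succ = A i j := rfl

theorem mul_padZero {a b : Type*} [Fintype b] (B : Matrix a b ℝ) (A : Matrix b (Fin m) ℝ) :
    B * padZero A = padZero (B * A) := by
  ext i j
  refine Fin.cases ?_ (fun j => ?_) j <;> simp [Matrix.mul_apply]

@[simp] theorem errorMatrix_zero (ε : Fin n → ℝ) (V : Matrix (Fin n) (Fin m) ℝ) (i : Fin n) :
    errorMatrix ε V i 0 = ε i := rfl

@[simp] theorem errorMatrix_succ (ε : Fin n → ℝ) (V : Matrix (Fin n) (Fin m) ℝ) (i : Fin n)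
    (j : Fin m) : errorMatrix ε V i j.succ = V i j := rfl

theorem errorMatrix_add (ε : Fin n → ℝ) (V A : Matrix (Fin n) (Fin m) ℝ) :
    errorMatrix ε (A + V) = errorMatrix ε V + padZero A := by
  ext i j
  refine Fin.cases ?_ (fun j => ?_) j <;> simp [add_comm]

/-- The normalised moments `(Zᵀ Z)^(-1/2) Zᵀ (ε X)` in terms of `Ψ` and `Zᵀ Z / n`. -/
noncomputable def sampleS (Pi0 : Matrix (Fin k) (Fin m) ℝ) (Ψ : Matrix (Fin k) (Fin (m + 1)) ℝ)
    (Y : Matrix (Fin k) (Fin k) ℝ) : Matrix (Fin k) (Fin (m + 1)) ℝ :=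
  Ψ + padZero (matSqrt Y * Pi0)

/-- The covariance estimator `(ε X)ᵀ M_Z (ε X) / (n - k)` in terms of `Ψ`, `(ε V)ᵀ (ε V) / n` and
`t = 1 / n`. -/
noncomputable def sampleW (Ψ : Matrix (Fin k) (Fin (m + 1)) ℝ)
    (E : Matrix (Fin (m + 1)) (Fin (m + 1)) ℝ) (t : ℝ) : Matrix (Fin (m + 1)) (Fin (m + 1)) ℝ :=
  (1 - k * t)⁻¹ • (E - t • (Ψᵀ * Ψ))

variable {Z : Matrix (Fin n) (Fin k) ℝ}

theorem projZ_eq (hZ : (Zᵀ * Z).PosDef) :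
    projZ Z = (matInvSqrt (Zᵀ * Z) * Zᵀ)ᵀ * (matInvSqrt (Zᵀ * Z) * Zᵀ) := by
  have h1 := matInvSqrt_mul_matSqrt hZ
  have h2 : (Zᵀ * Z)⁻¹ = matInvSqrt (Zᵀ * Z) * matInvSqrt (Zᵀ * Z) := by
    apply Matrix.inv_eq_left_inv
    calc _ = matInvSqrt (Zᵀ * Z) * (matInvSqrt (Zᵀ * Z) * matSqrt (Zᵀ * Z)) *
          matSqrt (Zᵀ * Z) := by
          simp only [Matrix.mul_assoc, matSqrt_mul_self hZ.posSemidef]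
      _ = 1 := by rw [h1, Matrix.mul_one, h1]
  rw [projZ, h2, Matrix.transpose_mul, Matrix.transpose_transpose, matInvSqrt_transpose]
  simp only [Matrix.mul_assoc]

theorem annihZ_mul (hZ : (Zᵀ * Z).PosDef) : annihZ Z * Z = 0 := by
  rw [annihZ, projZ, Matrix.sub_mul, Matrix.one_mul, Matrix.mul_assoc, Matrix.mul_assoc,
    Matrix.nonsing_inv_mul _ (by simpa using hZ.det_pos.ne'), Matrix.mul_one, sub_self]

theorem projZ_transpose (Z : Matrix (Fin n) (Fin k) ℝ) : (projZ Z)ᵀ = projZ Z := by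
  rw [projZ, Matrix.transpose_mul, Matrix.transpose_mul, Matrix.transpose_transpose,
    Matrix.transpose_nonsing_inv, gram_transpose, Matrix.mul_assoc]

theorem annihZ_transpose (Z : Matrix (Fin n) (Fin k) ℝ) : (annihZ Z)ᵀ = annihZ Z := by
  rw [annihZ, Matrix.transpose_sub, projZ_transpose, Matrix.transpose_one]

/-- As `M_Z` kills `Z`, the first-stage signal drops out: the covariance estimator built from `X`
equals the one built from `V`. -/
theorem mul_annihZ_mul_gram (hZ : (Zᵀ * Z).PosDef) (H : Matrix (Fin n) (Fin (m + 1)) ℝ)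
    (A : Matrix (Fin k) (Fin (m + 1)) ℝ) :
    (H + Z * A)ᵀ * annihZ Z * (H + Z * A) = Hᵀ * annihZ Z * H := by
  have h1 := annihZ_mul hZ
  have h2 : Zᵀ * annihZ Z = 0 := by
    rw [← Matrix.transpose_inj, Matrix.transpose_mul, annihZ_transpose, Matrix.transpose_transpose,
      h1, Matrix.transpose_zero]
  rw [Matrix.transpose_add, Matrix.transpose_mul, Matrix.add_mul, Matrix.mul_assoc Aᵀ, h2,
    Matrix.mul_zero, add_zero, Matrix.mul_add, ← Matrix.mul_assoc _ Z, Matrix.mul_assoc _ _ Z, h1,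
    Matrix.mul_zero, Matrix.zero_mul, add_zero]

theorem instrument_mul (hn : 0 < n) (hZ : (Zᵀ * Z).PosDef) :
    matInvSqrt (Zᵀ * Z) * Zᵀ * (Z * ((Real.sqrt n)⁻¹ • (1 : Matrix (Fin k) (Fin k) ℝ))) =
      matSqrt ((n : ℝ)⁻¹ • (Zᵀ * Z)) := by
  rw [matSqrt_smul hZ.posSemidef (by positivity), Real.sqrt_inv, Matrix.mul_smul, Matrix.mul_smul,
    Matrix.mul_one, Matrix.mul_assoc]
  congr 1
  conv_lhs => rw [← matSqrt_mul_self hZ.posSemidef]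
  rw [← Matrix.mul_assoc, matSqrt_mul_self hZ.posSemidef, matInvSqrt_mul_matSqrt hZ, Matrix.one_mul]

variable {Pi0 : Matrix (Fin k) (Fin m) ℝ} {β : Fin m → ℝ} {ε : Fin n → ℝ}
  {X V : Matrix (Fin n) (Fin m) ℝ} {y : Fin n → ℝ}

theorem instrument_mul_errorMatrix (hn : 0 < n) (hZ : (Zᵀ * Z).PosDef)
    (hX : X = Z * ((Real.sqrt n)⁻¹ • Pi0) + V) :
    matInvSqrt (Zᵀ * Z) * Zᵀ * errorMatrix ε X =
      sampleS Pi0 (Psi Z ε V) ((n : ℝ)⁻¹ • (Zᵀ * Z)) := by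
  rw [hX, errorMatrix_add, Matrix.mul_add, mul_padZero, sampleS, Psi, Matrix.mul_assoc,
    ← instrument_mul hn hZ]
  congr 2
  simp only [Matrix.mul_assoc, Matrix.smul_mul, Matrix.mul_smul, Matrix.one_mul]

theorem errorMatrix_annihZ (hn : 0 < n) (hZ : (Zᵀ * Z).PosDef)
    (hX : X = Z * ((Real.sqrt n)⁻¹ • Pi0) + V) (hk : (n : ℝ) - k ≠ 0) :
    (errorMatrix ε X)ᵀ * annihZ Z * errorMatrix ε X = ((n : ℝ) - k) •
      sampleW (Psi Z ε V) ((n : ℝ)⁻¹ • ((errorMatrix ε V)ᵀ * errorMatrix ε V)) (n : ℝ)⁻¹ := by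
  rw [hX, errorMatrix_add, ← mul_padZero, mul_annihZ_mul_gram hZ, annihZ, projZ_eq hZ,
    Matrix.mul_sub, Matrix.sub_mul, Matrix.mul_one, sampleW, smul_smul]
  have hΨ : Psi Z ε V = matInvSqrt (Zᵀ * Z) * Zᵀ * errorMatrix ε V := by
    rw [Psi, Matrix.mul_assoc]
  have hn' : (n : ℝ) ≠ 0 := by positivity
  -- The degrees of freedom `n - k` cancel against `1 - k/n` up to the factor `n` that normalises
  -- the error moments.
  have hc : ((n : ℝ) - k) * (1 - k * (n : ℝ)⁻¹)⁻¹ = n := by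
    have : (1 - k * (n : ℝ)⁻¹) = (n - k) / n := by field_simp
    rw [this]
    field_simp
  rw [hc, ← smul_sub, smul_smul, mul_inv_cancel₀ hn', one_smul, hΨ]
  congr 1
  rw [Matrix.transpose_mul _ (errorMatrix ε V)]
  simp only [Matrix.mul_assoc]

theorem outcome_sub (hy : y = X *ᵥ β + ε) (b : Fin m → ℝ) :
    y - X *ᵥ b = errorMatrix ε X *ᵥ (Fin.cons 1 (β - b) : Fin (m + 1) → ℝ) := by
  funext i
  rw [hy]
  simp only [Pi.sub_apply, Pi.add_apply, Matrix.mulVec, dotProduct, Fin.sum_univ_succ,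
    errorMatrix_zero, errorMatrix_succ, Fin.cons_zero, Fin.cons_succ, mul_sub,
    Finset.sum_sub_distrib, mul_one]
  ring

/-- At `b = β` the residual is `ε`, so `X̃` removes from each column of `X` its `W`-regression on
`ε`; this is right multiplication by `schurMatrix W`. For the infimum, `b ↦ (1, β - b)` is onto the
slice `v 0 = 1`, and positive definiteness of `W` makes every `b` admissible. -/
theorem statistics_eq (hn : 0 < n) (hk : 0 < (n : ℝ) - k) (hZ : (Zᵀ * Z).PosDef)
    (hX : X = Z * ((Real.sqrt n)⁻¹ • Pi0) + V) (hy : y = X *ᵥ β + ε)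
    {S : Matrix (Fin k) (Fin (m + 1)) ℝ} {W : Matrix (Fin (m + 1)) (Fin (m + 1)) ℝ}
    (hS : S = sampleS Pi0 (Psi Z ε V) ((n : ℝ)⁻¹ • (Zᵀ * Z)))
    (hW : W = sampleW (Psi Z ε V) ((n : ℝ)⁻¹ • ((errorMatrix ε V)ᵀ * errorMatrix ε V)) (n : ℝ)⁻¹)
    (hWpos : W.PosDef) :
    lambdas Z X y β = momentLambdas S W ∧ likelihoodRatio Z X y β = momentLR S W := by
  have hBH := instrument_mul_errorMatrix (ε := ε) hn hZ hX
  have hMH := errorMatrix_annihZ (ε := ε) hn hZ hX hk.ne'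
  rw [← hS] at hBH
  rw [← hW] at hMH
  set H := errorMatrix ε X with hH
  have hPH : Hᵀ * projZ Z * H = Sᵀ * S := by
    rw [projZ_eq hZ, ← hBH, Matrix.transpose_mul (matInvSqrt (Zᵀ * Z) * Zᵀ) H]
    simp only [Matrix.mul_assoc]
  have hexp : ∀ b, explainedSS Z X y b =
      (Fin.cons 1 (β - b) : Fin (m + 1) → ℝ) ⬝ᵥ ((Sᵀ * S) *ᵥ Fin.cons 1 (β - b)) := by
    intro b
    rw [explainedSS, outcome_sub hy, dotProduct_congr_mulVec, hPH]
  have hres : ∀ b, residualSS Z X y b = ((n : ℝ) - k) *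
      ((Fin.cons 1 (β - b) : Fin (m + 1) → ℝ) ⬝ᵥ (W *ᵥ Fin.cons 1 (β - b))) := by
    intro b
    rw [residualSS, outcome_sub hy, dotProduct_congr_mulVec, hMH, Matrix.smul_mulVec,
      dotProduct_smul, smul_eq_mul]
  have hW00 := hWpos.diag_pos (i := 0)
  have hquad : ∀ b : Fin m → ℝ,
      0 < (Fin.cons 1 (β - b) : Fin (m + 1) → ℝ) ⬝ᵥ (W *ᵥ Fin.cons 1 (β - b)) := fun b =>
    (posDef_iff_mem_positiveForms.1 hWpos).2 _ fun h => by
      have := congrFun h 0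
      simp at this
  have hβ : ∀ A : Matrix (Fin (m + 1)) (Fin (m + 1)) ℝ,
      (Fin.cons 1 (β - β) : Fin (m + 1) → ℝ) ⬝ᵥ (A *ᵥ Fin.cons 1 (β - β)) = A 0 0 := by
    intro A
    simp [dotProduct, Matrix.mulVec, Fin.sum_univ_succ]
  constructor
  · have hT : xTilde Z X y β = H * schurMatrix W := by
      have h1 : y - X *ᵥ β = ε := by rw [hy]; simp
      have h2 : ε = H.col 0 := rfl
      ext i j
      rw [mul_schurMatrix_apply, xTilde, hres, hβ, h1]
      have h3 : (ε ᵥ* (annihZ Z * X)) j = ((n : ℝ) - k) * W 0 j.succ := by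
        have := congrFun (congrFun hMH 0) j.succ
        rw [Matrix.smul_apply, smul_eq_mul] at this
        rw [← this, Matrix.mul_assoc, Matrix.mul_apply]
        rfl
      simp only [Matrix.sub_apply, Matrix.vecMulVec_apply, Pi.smul_apply, h3, smul_eq_mul, hH,
        errorMatrix_succ, errorMatrix_zero]
      field_simp
    rw [lambdas, momentLambdas, concentrationMatrix]
    have h4 : (xTilde Z X y β)ᵀ * annihZ Z * xTilde Z X y β = ((n : ℝ) - k) • condCov W := by
      rw [hT, condCov_eq hW00.ne', ← Matrix.smul_mul, ← Matrix.mul_smul, ← hMH,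
        Matrix.transpose_mul]
      simp only [Matrix.mul_assoc]
    have h5 : (xTilde Z X y β)ᵀ * projZ Z * xTilde Z X y β =
        (S * schurMatrix W)ᵀ * (S * schurMatrix W) := by
      rw [hT, Matrix.transpose_mul, Matrix.transpose_mul]
      calc _ = (schurMatrix W)ᵀ * (Hᵀ * projZ Z * H) * schurMatrix W := by
            simp only [Matrix.mul_assoc]
        _ = _ := by rw [hPH]; simp only [Matrix.mul_assoc]
    have h6 : (((n : ℝ) - k) • condCov W)⁻¹ = ((n : ℝ) - k)⁻¹ • (condCov W)⁻¹ := by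
      apply Matrix.inv_eq_left_inv
      rw [Matrix.smul_mul, Matrix.mul_smul, smul_smul, inv_mul_cancel₀ hk.ne', one_smul,
        Matrix.nonsing_inv_mul _ (by simpa using (condCov_posDef hWpos).det_pos.ne')]
    rw [h4, h5, h6, Matrix.smul_mul, smul_smul, mul_inv_cancel₀ hk.ne', one_smul]
  · have hne : ∀ b, residualSS Z X y b ≠ 0 := fun b => by
      rw [hres]; exact (mul_pos hk (hquad b)).ne'
    have : Nonempty {b : Fin m → ℝ // residualSS Z X y b ≠ 0} := ⟨⟨β, hne β⟩⟩
    have hv : Set.range (fun b : {b : Fin m → ℝ // residualSS Z X y b ≠ 0} =>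
        (Fin.cons 1 (β - b.1) : Fin (m + 1) → ℝ)) = {x | x 0 = 1} := by
      ext x
      constructor
      · rintro ⟨b, rfl⟩; rfl
      · intro (hx : x 0 = 1)
        refine ⟨⟨β - Fin.tail x, hne _⟩, ?_⟩
        simp only [sub_sub_cancel]
        rw [← hx, Fin.cons_self_tail]
    rw [likelihoodRatio, momentLR, ← iInf_ratio_eq_sortedEigenvalues hWpos (gram_transpose S) _ hv,
      Real.mul_iInf_of_nonneg hk.le, hexp, hres, hβ, hβ]
    congr 1
    · field_simp
    · refine iInf_congr fun b => ?_
      rw [hexp, hres]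
      have := hquad b.1
      field_simp

end FiniteSample

/-! ### The limit likelihood ratio in chi-squared coordinates -/

section Representation

variable {k m : ℕ}

/-- The columns of `D` are orthogonal. Normalise the nonzero ones and extend to a basis; a column
with `lam j = 0` vanishes, so its basis vector is arbitrary. -/
theorem exists_orthonormalBasis_of_gram_diagonal (hmk : m ≤ k) {D : Matrix (Fin k) (Fin m) ℝ}
    {lam : Fin m → ℝ} (hD : Dᵀ * D = Matrix.diagonal lam) :
    ∃ b : OrthonormalBasis (Fin m ⊕ Fin (k - m)) ℝ (EuclideanSpace ℝ (Fin k)),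
      ∀ j i, D i j = Real.sqrt (lam j) * b (Sum.inl j) i := by
  have hin : ∀ i j, inner ℝ (WithLp.toLp 2 (D.col i) : EuclideanSpace ℝ (Fin k))
      (WithLp.toLp 2 (D.col j)) = Matrix.diagonal lam i j := by
    intro i j
    rw [← hD, Matrix.mul_apply]
    simp [PiLp.inner_apply, mul_comm]
  have hlam : ∀ j, 0 ≤ lam j := by
    intro j
    have := hin j j
    rw [Matrix.diagonal_apply_eq] at this
    rw [← this]
    exact real_inner_self_nonneg
  set v : Fin m ⊕ Fin (k - m) → EuclideanSpace ℝ (Fin k) :=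
    Sum.elim (fun j => (Real.sqrt (lam j))⁻¹ • WithLp.toLp 2 (D.col j)) (fun _ => 0) with hv
  set s : Set (Fin m ⊕ Fin (k - m)) := {x | ∃ j, x = Sum.inl j ∧ lam j ≠ 0} with hs
  have hort : Orthonormal ℝ (s.domRestrict v) := by
    rw [orthonormal_iff_ite]
    rintro ⟨_, i, rfl, hi⟩ ⟨_, j, rfl, hj⟩
    simp only [Set.domRestrict_apply, hv, Sum.elim_inl, inner_smul_left, inner_smul_right, hin]
    by_cases hij : i = j
    · subst hij
      have h1 := Real.mul_self_sqrt (hlam i)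
      have h2 : Real.sqrt (lam i) ≠ 0 := (Real.sqrt_pos.2 (lt_of_le_of_ne (hlam i) hi.symm)).ne'
      simp only [Matrix.diagonal_apply_eq, if_true]
      simp only [conj_trivial]
      field_simp
      rw [sq, h1]
    · simp [hij]
  obtain ⟨b, hb⟩ := hort.exists_orthonormalBasis_extension_of_card_eq (by simp; omega)
  refine ⟨b, fun j i => ?_⟩
  by_cases hj : lam j = 0
  · have h0 : WithLp.toLp 2 (D.col j) = (0 : EuclideanSpace ℝ (Fin k)) := by
      rw [← inner_self_eq_zero (𝕜 := ℝ), hin, Matrix.diagonal_apply_eq, hj]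
    have : D i j = 0 := congrArg (fun x : EuclideanSpace ℝ (Fin k) => x i) h0
    rw [this, hj]
    simp
  · rw [hb (Sum.inl j) ⟨j, rfl, hj⟩]
    have h2 : Real.sqrt (lam j) ≠ 0 :=
      (Real.sqrt_pos.2 (lt_of_le_of_ne (hlam j) (Ne.symm hj))).ne'
    simp [hv, h2]

/-- The squared coordinates of `ξ` along the first `m` basis vectors, preceded by the squared length
of the remaining component. -/
noncomputable def chiCoordinates {E : Type*} [NormedAddCommGroup E] [InnerProductSpace ℝ E]
    {r : ℕ} (b : OrthonormalBasis (Fin m ⊕ Fin r) ℝ E) (ξ : E) : Fin (m + 1) → ℝ :=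
  Fin.cons (∑ i, inner ℝ (b (Sum.inr i)) ξ ^ 2) fun j => inner ℝ (b (Sum.inl j)) ξ ^ 2

/-- The order of quantifiers is the point: `b` is chosen from `G` before `S` and `ξ`, so a vector
`ξ` independent of `G` keeps the same law of coordinates. -/
theorem exists_basis_momentLR (hmk : m ≤ k) {W : Matrix (Fin (m + 1)) (Fin (m + 1)) ℝ}
    (hW : W.PosDef) (G : Matrix (Fin k) (Fin m) ℝ) :
    ∃ b : OrthonormalBasis (Fin m ⊕ Fin (k - m)) ℝ (EuclideanSpace ℝ (Fin k)),
      ∀ (S : Matrix (Fin k) (Fin (m + 1)) ℝ) (ξ : EuclideanSpace ℝ (Fin k)),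
        S * schurMatrix W = G → (∀ i, S i 0 = Real.sqrt (W 0 0) * ξ i) →
        momentLR S W = limitLR (sortedEigenvalues ((condCov W)⁻¹ * (Gᵀ * G)))
          (chiCoordinates b ξ) := by
  have hC := condCov_posDef hW
  have hW00 : 0 < W 0 0 := hW.diag_pos
  obtain ⟨R, hR1, hR2, hR3⟩ := exists_simultaneous_diagonalization hC (gram_transpose G)
  set lam := sortedEigenvalues ((condCov W)⁻¹ * (Gᵀ * G)) with hlam
  have hD : (G * R)ᵀ * (G * R) = Matrix.diagonal lam := by
    rw [← hR3, Matrix.transpose_mul]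
    simp only [Matrix.mul_assoc]
  obtain ⟨b, hb⟩ := exists_orthonormalBasis_of_gram_diagonal hmk hD
  refine ⟨b, fun S ξ hSG hSξ => ?_⟩
  set c : ℝ := (Real.sqrt (W 0 0))⁻¹ with hc
  have hsq : Real.sqrt (W 0 0) ≠ 0 := (Real.sqrt_pos.2 hW00).ne'
  have hcW : c * W 0 0 * c = 1 := by
    have := Real.mul_self_sqrt hW00.le
    rw [hc]; field_simp; rw [sq, this]
  -- A `W`-orthonormal basis: the scaled first coordinate vector, followed by the residual
  -- directions rotated by `R` so that the Gram matrix of `G` becomes diagonal. In this basis `SᵀS`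
  -- is an arrow matrix.
  set U : Matrix (Fin (m + 1)) (Fin (m + 1)) ℝ :=
    Matrix.of fun i =>
      (Fin.cons ((Pi.single 0 c : Fin (m + 1) → ℝ) i) ((schurMatrix W * R) i) : Fin (m + 1) → ℝ)
    with hU
  have hU0 : ∀ i, U i 0 = (Pi.single 0 c : Fin (m + 1) → ℝ) i := fun _ => rfl
  have hUs : ∀ i (j : Fin m), U i j.succ = (schurMatrix W * R) i j := fun _ _ => rfl
  have hBU0 : ∀ {a : Type} (B : Matrix a (Fin (m + 1)) ℝ) (i : a), (B * U) i 0 = B i 0 * c := by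
    intro a B i
    rw [Matrix.mul_apply]
    simp [hU0, Pi.single_apply]
  have hBUs : ∀ {a : Type} (B : Matrix a (Fin (m + 1)) ℝ) (i : a) (j : Fin m),
      (B * U) i j.succ = (B * (schurMatrix W * R)) i j := by
    intro a B i j
    rw [Matrix.mul_apply, Matrix.mul_apply]
    simp only [hUs]
  have hSU0 : ∀ i, (S * U) i 0 = ξ i := by
    intro i
    rw [hBU0, hSξ, hc]
    field_simp
  have hSUs : ∀ i (j : Fin m), (S * U) i j.succ = Real.sqrt (lam j) * b (Sum.inl j) i := by
    intro i j
    rw [hBUs, ← Matrix.mul_assoc, hSG, hb]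
  have hWU : Uᵀ * W * U = 1 := by
    have hrow : ∀ j, (W * (schurMatrix W * R)) 0 j = 0 := by
      intro j
      rw [← Matrix.mul_assoc, Matrix.mul_apply]
      exact Finset.sum_eq_zero fun i _ => by rw [mul_schurMatrix_zero hW00.ne', zero_mul]
    have hWt := (posDef_iff_mem_positiveForms.1 hW).1
    have hsymm : (Uᵀ * W * U)ᵀ = Uᵀ * W * U := by
      simp only [Matrix.transpose_mul, Matrix.transpose_transpose, hWt, Matrix.mul_assoc]
    have h0s : ∀ j : Fin m, (Uᵀ * W * U) 0 j.succ = 0 := by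
      intro j
      rw [Matrix.mul_assoc, Matrix.mul_apply]
      refine Finset.sum_eq_zero fun i _ => ?_
      rw [Matrix.transpose_apply, hU0, hBUs]
      by_cases hi : i = 0
      · rw [hi, hrow, mul_zero]
      · rw [Pi.single_eq_of_ne hi, zero_mul]
    ext i j
    refine Fin.cases ?_ (fun i => ?_) i <;> refine Fin.cases ?_ (fun j => ?_) j
    · rw [hBU0, Matrix.mul_apply]
      simp [hU0, Pi.single_apply, hcW]
    · rw [h0s, Matrix.one_apply_ne (Fin.succ_ne_zero j).symm]
    · rw [← hsymm, Matrix.transpose_apply, h0s, Matrix.one_apply_ne (Fin.succ_ne_zero i)]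
    · have h1 : (Uᵀ * W * U) i.succ j.succ =
          ((schurMatrix W * R)ᵀ * W * (schurMatrix W * R)) i j := by
        rw [Matrix.mul_assoc, Matrix.mul_assoc, Matrix.mul_apply, Matrix.mul_apply]
        simp only [Matrix.transpose_apply, hUs, hBUs]
      have h2 : (schurMatrix W * R)ᵀ * W * (schurMatrix W * R) = 1 := by
        rw [← hR1, condCov_eq hW00.ne', Matrix.transpose_mul]
        simp only [Matrix.mul_assoc]
      rw [h1, h2]
      simp [Matrix.one_apply]
  have hUU : U * Uᵀ = W⁻¹ := by
    symm
    apply Matrix.inv_eq_left_inv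
    rw [Matrix.mul_assoc]
    exact mul_eq_one_comm.1 hWU
  have hsum : ∑ i, chiCoordinates b ξ i = ∑ i, ξ i ^ 2 := by
    have h1 := b.sum_sq_norm_inner_right ξ
    rw [Fintype.sum_sum_type, EuclideanSpace.norm_sq_eq] at h1
    simp only [Real.norm_eq_abs, sq_abs] at h1
    rw [← h1, Fin.sum_univ_succ, add_comm]
    rfl
  have harrow : Uᵀ * (Sᵀ * S) * U = arrowMatrix (∑ i, chiCoordinates b ξ i)
      (fun j => Real.sqrt (lam j) * inner ℝ (b (Sum.inl j)) ξ) lam := by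
    have h1 : Uᵀ * (Sᵀ * S) * U = (S * U)ᵀ * (S * U) := by
      rw [Matrix.transpose_mul]
      simp only [Matrix.mul_assoc]
    have h2 : ∀ j : Fin m, ((S * U)ᵀ * (S * U)) 0 j.succ =
        Real.sqrt (lam j) * inner ℝ (b (Sum.inl j)) ξ := by
      intro j
      rw [Matrix.mul_apply, PiLp.inner_apply, Finset.mul_sum]
      refine Finset.sum_congr rfl fun i _ => ?_
      rw [Matrix.transpose_apply, hSU0, hSUs]
      simp
      ring
    rw [h1, hsum]
    ext i j
    refine Fin.cases ?_ (fun i => ?_) i <;> refine Fin.cases ?_ (fun j => ?_) j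
    · rw [Matrix.mul_apply]
      simp only [Matrix.transpose_apply, hSU0, arrowMatrix_zero_zero, sq]
    · rw [h2, arrowMatrix_zero_succ]
    · rw [← gram_transpose, Matrix.transpose_apply, h2, arrowMatrix_succ_zero]
    · rw [arrowMatrix_succ_succ, ← hD, Matrix.mul_apply, Matrix.mul_apply]
      simp only [Matrix.transpose_apply, hSUs, hb]
  have hlam0 : ∀ j, 0 ≤ lam j :=
    sortedEigenvalues_inv_mul_nonneg hC (gram_transpose G) (gram_quadratic_nonneg G)
  have hpoly : (W⁻¹ * (Sᵀ * S)).charpoly = limitPoly lam (chiCoordinates b ξ) := by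
    rw [charpoly_inv_mul_eq hUU, harrow]
    refine charpoly_arrowMatrix_eq_limitPoly fun j => ?_
    rw [mul_pow, Real.sq_sqrt (hlam0 j)]
    rfl
  rw [momentLR, limitLR, (isLeast_muMin (charpoly_inv_mul_splits hW (gram_transpose S)) hpoly).2]
  congr 1
  rw [hsum, Matrix.mul_apply, Finset.sum_div]
  refine Finset.sum_congr rfl fun i _ => ?_
  rw [Matrix.transpose_apply, hSξ, div_eq_iff hW00.ne']
  have := Real.mul_self_sqrt hW00.le
  linear_combination (ξ i ^ 2) * this

end Representation

/-! ### Continuous mapping and convergence in distribution -/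

section WeakConvergence

variable {Ω Ω' : Type*} [MeasurableSpace Ω] [MeasurableSpace Ω'] {P : Measure Ω}
  [IsProbabilityMeasure P] {P' : Measure Ω'} [IsProbabilityMeasure P']
  {E : Type*} [TopologicalSpace E] [MeasurableSpace E] [BorelSpace E]

/-- Continuous mapping theorem for a map that is continuous on an open set carrying the limit,
relative to a set `K` that contains the sequence. -/
theorem tendstoInDistribution_of_continuousOn [HasOuterApproxClosed E] {F : Type*}
    [TopologicalSpace F] [MeasurableSpace F] [BorelSpace F] {D : ℕ → Ω → E}
    {D' : Ω' → E} {T : ℕ → Ω → F}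
    {g : E → F} {O K : Set E}
    (hD : TendstoInDistribution D atTop D' (fun _ => P) P') (hO : IsOpen O)
    (hg : ContinuousOn g (O ∩ K)) (hK : ∀ n ω, D n ω ∈ K)
    (hT : ∀ᶠ n in atTop, ∀ ω, D n ω ∈ O → T n ω = g (D n ω))
    (hlim : ∀ᵐ ω ∂P', D' ω ∈ O ∩ K)
    (hTm : ∀ n, AEMeasurable (T n) P) (hT'm : AEMeasurable (fun ω => g (D' ω)) P') :
    TendstoInDistribution T atTop (fun ω => g (D' ω)) (fun _ => P) P' := by
  refine ⟨hTm, hT'm, tendsto_of_forall_isOpen_le_liminf' fun G hG => ?_⟩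
  -- On `O ∩ K` the preimage of `G` is cut out by an open set `u`. The portmanteau inequality is
  -- applied to the open set `u ∩ O`, while `K` need not be open because the sequence never leaves
  -- it. Off `O` nothing is required of `T n`.
  obtain ⟨u, hu, hug⟩ := continuousOn_iff'.1 hg G hG
  have hlow := ProbabilityMeasure.le_liminf_measure_open_of_tendsto hD.tendsto (hu.inter hO)
  simp only [ProbabilityMeasure.coe_mk] at hlow ⊢
  rw [Measure.map_apply_of_aemeasurable hT'm hG.measurableSet]
  rw [Measure.map_apply_of_aemeasurable hD.aemeasurable_limit (hu.inter hO).measurableSet] at hlow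
  refine le_trans ?_ (hlow.trans ?_)
  · refine measure_mono_ae ?_
    filter_upwards [hlim] with ω hω hωG
    have : D' ω ∈ u ∩ (O ∩ K) := hug ▸ ⟨hωG, hω⟩
    exact ⟨this.1, this.2.1⟩
  · refine liminf_le_liminf ?_
    filter_upwards [hT] with n hn
    rw [Measure.map_apply_of_aemeasurable (hTm n) hG.measurableSet,
      Measure.map_apply_of_aemeasurable (hD.forall_aemeasurable n) (hu.inter hO).measurableSet]
    refine measure_mono fun ω hω => ?_
    have : D n ω ∈ g ⁻¹' G ∩ (O ∩ K) := hug ▸ ⟨hω.1, hω.2, hK n ω⟩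
    show T n ω ∈ G
    rw [hn ω hω.2]
    exact this.1

theorem tendstoInDistribution_of_map_eq {Ω'' : Type*} [MeasurableSpace Ω''] {P'' : Measure Ω''}
    [IsProbabilityMeasure P''] {T : ℕ → Ω → E} {T' : Ω' → E} {T'' : Ω'' → E}
    (h : TendstoInDistribution T atTop T' (fun _ => P) P') (hm : AEMeasurable T'' P'')
    (heq : P'.map T' = P''.map T'') : TendstoInDistribution T atTop T'' (fun _ => P) P'' := by
  refine ⟨h.forall_aemeasurable, hm, ?_⟩
  have h2 := h.tendsto
  have h3 : (⟨P'.map T', Measure.isProbabilityMeasure_map h.aemeasurable_limit⟩ :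
      ProbabilityMeasure E) = ⟨P''.map T'', Measure.isProbabilityMeasure_map hm⟩ :=
    Subtype.ext heq
  rwa [h3] at h2

theorem tendsto_integral_of_tendstoInDistribution {T : ℕ → Ω → E} {T' : Ω' → E}
    (h : TendstoInDistribution T atTop T' (fun _ => P) P') (f : E →ᵇ ℝ) :
    Tendsto (fun n => ∫ ω, f (T n ω) ∂P) atTop (𝓝 (∫ ω, f (T' ω) ∂P')) := by
  have h2 := (ProbabilityMeasure.tendsto_iff_forall_integral_tendsto.1 h.tendsto) f
  simp only [ProbabilityMeasure.coe_mk] at h2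
  rw [integral_map h.aemeasurable_limit f.continuous.measurable.aestronglyMeasurable] at h2
  refine h2.congr fun n => ?_
  rw [integral_map (h.forall_aemeasurable n) f.continuous.measurable.aestronglyMeasurable]

/-- The integrand is continuous away from `frontier A × ℝ`, which the limit avoids almost surely. -/
theorem tendsto_integral_indicator {E₁ : Type*} [TopologicalSpace E₁] [MeasurableSpace E₁]
    [BorelSpace E₁] [HasOuterApproxClosed (E₁ × ℝ)] [BorelSpace (E₁ × ℝ)]
    {L : ℕ → Ω → E₁} {R : ℕ → Ω → ℝ} {L' : Ω' → E₁} {R' : Ω' → ℝ}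
    (h : TendstoInDistribution (fun n ω => (L n ω, R n ω)) atTop (fun ω => (L' ω, R' ω))
      (fun _ => P) P') {A : Set E₁} (hA : MeasurableSet A) (hfr : P' {ω | L' ω ∈ frontier A} = 0)
    (f : ℝ →ᵇ ℝ) :
    Tendsto (fun n => ∫ ω, A.indicator (fun _ => f (R n ω)) (L n ω) ∂P) atTop
      (𝓝 (∫ ω, A.indicator (fun _ => f (R' ω)) (L' ω) ∂P')) := by
  set g : E₁ × ℝ → ℝ := fun p => (A ×ˢ Set.univ).indicator (fun p => f p.2) p with hg
  have hgeq : ∀ a r, g (a, r) = A.indicator (fun _ => f r) a := by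
    intro a r
    by_cases ha : a ∈ A <;> simp [hg, ha]
  have hbound : ∀ p, ‖g p‖ ≤ ‖f‖ := fun p =>
    (norm_indicator_le_norm_self _ _).trans (f.norm_coe_le_norm _)
  have hgm : Measurable g :=
    (f.continuous.measurable.comp measurable_snd).indicator (hA.prod MeasurableSet.univ)
  have hO : IsOpen {p : E₁ × ℝ | p.1 ∉ frontier A} :=
    isClosed_frontier.isOpen_compl.preimage continuous_fst
  have hcont : ContinuousOn g ({p : E₁ × ℝ | p.1 ∉ frontier A} ∩ Set.univ) := by
    rintro ⟨a, r⟩ ⟨hp, -⟩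
    refine ContinuousAt.continuousWithinAt ?_
    refine ContinuousOn.continuousAt_indicator (f := fun p : E₁ × ℝ => f p.2)
      (f.continuous.comp continuous_snd).continuousOn ?_
    rw [frontier_prod_univ_eq]
    exact fun h => hp h.1
  have key := tendstoInDistribution_of_continuousOn (T := fun n ω => g (L n ω, R n ω)) h hO hcont
    (fun _ _ => trivial) (Eventually.of_forall fun n ω _ => rfl)
    (by
      rw [ae_iff]
      refine measure_mono_null ?_ hfr
      intro ω hω
      by_contra hc
      exact hω ⟨hc, trivial⟩)
    (fun n => hgm.comp_aemeasurable (h.forall_aemeasurable n))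
    (hgm.comp_aemeasurable h.aemeasurable_limit)
  -- Clamping to `[-‖f‖, ‖f‖]` fixes every value of `g`; it serves as a bounded substitute for the
  -- identity test function.
  set φ : ℝ →ᵇ ℝ := BoundedContinuousFunction.ofNormedAddCommGroup
    (fun x => max (-‖f‖) (min x ‖f‖)) (by fun_prop) ‖f‖ (fun x => by
      rw [Real.norm_eq_abs, abs_le]
      refine ⟨le_max_left _ _, max_le (by linarith [norm_nonneg f]) (min_le_right _ _)⟩) with hφ
  have hφg : ∀ p, φ (g p) = g p := by
    intro p
    have := abs_le.1 (hbound p)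
    show max (-‖f‖) (min (g p) ‖f‖) = g p
    rw [min_eq_left this.2, max_eq_right this.1]
  have := tendsto_integral_of_tendstoInDistribution key φ
  simp only [hφg] at this
  simpa only [hgeq] using this

end WeakConvergence

theorem tendstoInMeasure_pi {Ω : Type*} [MeasurableSpace Ω] {P : Measure Ω}
    {ι : Type*} [Fintype ι] {f : ℕ → Ω → ι → ℝ} {g : Ω → ι → ℝ}
    (h : ∀ i, TendstoInMeasure P (fun n ω => f n ω i) atTop (fun ω => g ω i)) :
    TendstoInMeasure P f atTop g := by
  intro ε hε
  have hsum : Tendsto (fun n => ∑ i, P {ω | ε ≤ edist (f n ω i) (g ω i)}) atTop (𝓝 0) := by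
    have := tendsto_finsetSum Finset.univ fun i (_ : i ∈ Finset.univ) => h i ε hε
    simpa using this
  refine tendsto_of_tendsto_of_tendsto_of_le_of_le tendsto_const_nhds hsum (fun _ => zero_le)
    fun n => ?_
  refine le_trans (measure_mono ?_) (measure_iUnion_fintype_le P
    fun i => {ω | ε ≤ edist (f n ω i) (g ω i)})
  intro ω hω
  by_contra hc
  simp only [Set.mem_iUnion, not_exists, Set.mem_ofPred_eq, not_le] at hc
  have : edist (f n ω) (g ω) < ε := by
    rw [edist_pi_def, Finset.sup_lt_iff hε]
    exact fun i _ => hc i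
  exact absurd hω (not_le.2 this)

/-! ### Measurability of random matrices, spectra and infima -/

section Measurability

variable {Ω : Type*} [MeasurableSpace Ω] {a b c : ℕ}

/-- Entrywise measurability of a random matrix. -/
def MeasurableEntries (M : Ω → Matrix (Fin a) (Fin b) ℝ) : Prop :=
  ∀ i j, Measurable fun ω => M ω i j

theorem MeasurableEntries.mul {M : Ω → Matrix (Fin a) (Fin b) ℝ} {N : Ω → Matrix (Fin b) (Fin c) ℝ}
    (hM : MeasurableEntries M) (hN : MeasurableEntries N) :
    MeasurableEntries fun ω => M ω * N ω := fun i j => by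
  simp only [Matrix.mul_apply]
  exact Finset.measurable_sum _ fun l _ => (hM i l).mul (hN l j)

theorem MeasurableEntries.add {M N : Ω → Matrix (Fin a) (Fin b) ℝ}
    (hM : MeasurableEntries M) (hN : MeasurableEntries N) :
    MeasurableEntries fun ω => M ω + N ω := fun i j => (hM i j).add (hN i j)

theorem MeasurableEntries.sub {M N : Ω → Matrix (Fin a) (Fin b) ℝ}
    (hM : MeasurableEntries M) (hN : MeasurableEntries N) :
    MeasurableEntries fun ω => M ω - N ω := fun i j => (hM i j).sub (hN i j)

theorem MeasurableEntries.transpose {M : Ω → Matrix (Fin a) (Fin b) ℝ}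
    (hM : MeasurableEntries M) : MeasurableEntries fun ω => (M ω)ᵀ := fun i j => hM j i

theorem MeasurableEntries.const_smul {M : Ω → Matrix (Fin a) (Fin b) ℝ}
    (hM : MeasurableEntries M) (r : ℝ) : MeasurableEntries fun ω => r • M ω :=
  fun i j => (hM i j).const_mul r

theorem measurableEntries_const (M : Matrix (Fin a) (Fin b) ℝ) :
    MeasurableEntries fun _ : Ω => M := fun _ _ => measurable_const

theorem MeasurableEntries.det {M : Ω → Matrix (Fin a) (Fin a) ℝ} (hM : MeasurableEntries M) :
    Measurable fun ω => (M ω).det := by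
  simp only [Matrix.det_apply]
  exact Finset.measurable_sum _ fun σ _ =>
    (Finset.measurable_prod _ fun i _ => hM _ _).const_smul _

theorem MeasurableEntries.inv {M : Ω → Matrix (Fin a) (Fin a) ℝ} (hM : MeasurableEntries M) :
    MeasurableEntries fun ω => (M ω)⁻¹ := fun i j => by
  simp only [Matrix.inv_def, Ring.inverse_eq_inv', Matrix.smul_apply, Matrix.adjugate_apply,
    smul_eq_mul]
  refine hM.det.inv.mul (MeasurableEntries.det fun r s => ?_)
  simp only [Matrix.updateRow_apply]
  split_ifs
  · exact measurable_const
  · exact hM r s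

theorem MeasurableEntries.quadratic {M : Ω → Matrix (Fin a) (Fin a) ℝ} {v : Ω → Fin a → ℝ}
    (hM : MeasurableEntries M) (hv : ∀ i, Measurable fun ω => v ω i) :
    Measurable fun ω => v ω ⬝ᵥ (M ω *ᵥ v ω) := by
  simp only [dotProduct, Matrix.mulVec]
  exact Finset.measurable_sum _ fun i _ => (hv i).mul
    (Finset.measurable_sum _ fun j _ => (hM i j).mul (hv j))

theorem continuous_restrict_sortedEigenvalues (a : ℕ) :
    Continuous fun A : {A : Fin a → Fin a → ℝ // (Matrix.of A).charpoly.Splits} =>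
      sortedEigenvalues (Matrix.of A.1) := by
  have h : Continuous fun A : {A : Fin a → Fin a → ℝ // (Matrix.of A).charpoly.Splits} => 
    (Matrix.of A.1) := continuous_subtype_val
  exact continuousOn_sortedEigenvalues.comp_continuous h fun A => A.2

/-- The map factors through the subtype of matrices with split characteristic polynomial, on which
sorting the eigenvalues is continuous. -/
theorem MeasurableEntries.measurable_sortedEigenvalues {M : Ω → Matrix (Fin a) (Fin a) ℝ}
    (hM : MeasurableEntries M) (hs : ∀ ω, (M ω).charpoly.Splits) :
    Measurable fun ω => sortedEigenvalues (M ω) := by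
  obtain ⟨N, hN⟩ : ∃ N : Ω → {A : Fin a → Fin a → ℝ // (Matrix.of A).charpoly.Splits},
      ∀ ω, Matrix.of (N ω).1 = M ω := ⟨fun ω => ⟨M ω, hs ω⟩, fun _ => rfl⟩
  have hNm : Measurable N := by
    refine measurable_comap_iff.2 ?_
    refine measurable_pi_lambda _ fun i => measurable_pi_lambda _ fun j => ?_
    have h : (fun ω => (Subtype.val ∘ N) ω i j) = fun ω => M ω i j := funext fun ω => by rw [← hN]; rfl
    rw [h]
    exact hM i j
  simp only [← hN]
  exact (continuous_restrict_sortedEigenvalues a).measurable.comp hNm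

/-- This trades an uncountable infimum for one over `D`, which may be countable. The quotient is
continuous on the open set `r ≠ 0`, which `D` meets densely; excluded points receive `⊤`. If no
point is admissible, both sides take the default value `0`. -/
theorem iInf_ratio_eq_toReal_iInf {E : Type*} [TopologicalSpace E] {D : Set E} (hD : Dense D)
    {r e : E → ℝ} (hr : Continuous r) (he : Continuous e) (hr0 : ∀ b, 0 ≤ r b)
    (he0 : ∀ b, 0 ≤ e b) :
    ⨅ b : {b // r b ≠ 0}, e b.1 / r b.1 =
      (⨅ d : D, if r d.1 = 0 then ⊤ else ENNReal.ofReal (e d.1 / r d.1)).toReal := by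
  have h1 : ⨅ b : {b // r b ≠ 0}, e b.1 / r b.1 =
      (⨅ b : {b // r b ≠ 0}, ENNReal.ofReal (e b.1 / r b.1)).toReal := by
    rw [ENNReal.toReal_iInf fun _ => ENNReal.ofReal_ne_top]
    exact iInf_congr fun b => (ENNReal.toReal_ofReal (div_nonneg (he0 _) (hr0 _))).symm
  rw [h1]
  congr 1
  refine le_antisymm (le_iInf fun d => ?_) (le_iInf fun b => ?_)
  · split_ifs with h
    · exact le_top
    · exact iInf_le (fun b : {b // r b ≠ 0} => ENNReal.ofReal (e b.1 / r b.1)) ⟨d.1, h⟩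
  · by_contra! hlt
    have hc : ContinuousAt (fun b => ENNReal.ofReal (e b / r b)) b.1 :=
      ENNReal.continuous_ofReal.continuousAt.comp (he.continuousAt.div hr.continuousAt b.2)
    have hev := (hc.eventually_lt continuousAt_const hlt).and
      (hr.continuousAt.eventually_ne b.2)
    obtain ⟨d, hdD, hd⟩ := hD.inter_nhds_nonempty hev
    refine absurd hd.1 (not_lt.2 ?_)
    refine (iInf_le _ (⟨d, hdD⟩ : D)).trans ?_
    rw [if_neg hd.2]

end Measurability

/-! ### Measurability and signs of the statistics -/

section StatisticMeasurability

variable {n k m : ℕ}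

theorem projZ_mul_self (Z : Matrix (Fin n) (Fin k) ℝ) : projZ Z * projZ Z = projZ Z := by
  by_cases h : IsUnit (Zᵀ * Z).det
  · rw [projZ]
    calc _ = Z * ((Zᵀ * Z)⁻¹ * (Zᵀ * Z)) * (Zᵀ * Z)⁻¹ * Zᵀ := by simp only [Matrix.mul_assoc]
      _ = _ := by rw [Matrix.nonsing_inv_mul _ h, Matrix.mul_one]
  -- A singular `ZᵀZ` has inverse `0` by convention, so `P_Z = 0` is still idempotent.
  · rw [projZ, Matrix.nonsing_inv_apply_not_isUnit _ h]
    simp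

theorem projZ_eq_gram (Z : Matrix (Fin n) (Fin k) ℝ) : projZ Z = (projZ Z)ᵀ * projZ Z := by
  rw [projZ_transpose, projZ_mul_self]

theorem annihZ_eq_gram (Z : Matrix (Fin n) (Fin k) ℝ) : annihZ Z = (annihZ Z)ᵀ * annihZ Z := by
  rw [annihZ_transpose]
  simp only [annihZ, Matrix.sub_mul, Matrix.mul_sub, Matrix.one_mul, Matrix.mul_one,
    projZ_mul_self, sub_self, sub_zero]

theorem quadratic_projZ_nonneg (Z : Matrix (Fin n) (Fin k) ℝ) (v : Fin n → ℝ) :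
    0 ≤ v ⬝ᵥ (projZ Z *ᵥ v) := by
  rw [projZ_eq_gram]
  exact gram_quadratic_nonneg _ _

theorem quadratic_annihZ_nonneg (Z : Matrix (Fin n) (Fin k) ℝ) (v : Fin n → ℝ) :
    0 ≤ v ⬝ᵥ (annihZ Z *ᵥ v) := by
  rw [annihZ_eq_gram]
  exact gram_quadratic_nonneg _ _

/-- This gives a real spectrum at every outcome, with no regularity event. When the denominator is
singular its conventional inverse is `0`, and the product is written as `1⁻¹ * 0`. The sign of `n -
k` explains the condition `k ≤ n`. -/
theorem exists_concentrationMatrix_eq (Z : Matrix (Fin n) (Fin k) ℝ) (X : Matrix (Fin n) (Fin m) ℝ)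
    (y : Fin n → ℝ) (β : Fin m → ℝ) :
    ∃ W B : Matrix (Fin m) (Fin m) ℝ, W.PosDef ∧ Bᵀ = B ∧
      (k ≤ n → ∀ v, 0 ≤ v ⬝ᵥ (B *ᵥ v)) ∧ concentrationMatrix Z X y β = W⁻¹ * B := by
  set A := (xTilde Z X y β)ᵀ * annihZ Z * xTilde Z X y β with hA
  have hsymm : ∀ M : Matrix (Fin n) (Fin n) ℝ, Mᵀ = M →
      ((xTilde Z X y β)ᵀ * M * xTilde Z X y β)ᵀ = (xTilde Z X y β)ᵀ * M * xTilde Z X y β := by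
    intro M hM
    simp only [Matrix.transpose_mul, Matrix.transpose_transpose, hM, Matrix.mul_assoc]
  by_cases hdet : A.det = 0
  · refine ⟨1, 0, Matrix.PosDef.one, Matrix.transpose_zero, fun _ v => by simp, ?_⟩
    rw [concentrationMatrix, ← hA, Matrix.nonsing_inv_apply_not_isUnit _ (by simp [hdet])]
    simp
  · have hpsd : A.PosSemidef := Matrix.PosSemidef.of_dotProduct_mulVec_nonneg
      (isHermitian_of_transpose_eq (hsymm _ (annihZ_transpose Z))) fun v => by
        rw [star_trivial, hA, ← dotProduct_congr_mulVec]
        exact quadratic_annihZ_nonneg Z _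
    refine ⟨A, ((n : ℝ) - k) • ((xTilde Z X y β)ᵀ * projZ Z * xTilde Z X y β),
      hpsd.posDef_iff_det_ne_zero.2 hdet, ?_, fun hkn v => ?_, ?_⟩
    · rw [Matrix.transpose_smul, hsymm _ (projZ_transpose Z)]
    · rw [Matrix.smul_mulVec, dotProduct_smul, smul_eq_mul, ← dotProduct_congr_mulVec]
      have : (k : ℝ) ≤ n := by exact_mod_cast hkn
      exact mul_nonneg (by linarith) (quadratic_projZ_nonneg Z _)
    · rw [concentrationMatrix, ← hA, Matrix.mul_smul]

theorem lambdas_nonneg (hkn : k ≤ n) (Z : Matrix (Fin n) (Fin k) ℝ) (X : Matrix (Fin n) (Fin m) ℝ)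
    (y : Fin n → ℝ) (β : Fin m → ℝ) (i : Fin m) : 0 ≤ lambdas Z X y β i := by
  obtain ⟨W, B, hW, hB, hpos, h⟩ := exists_concentrationMatrix_eq Z X y β
  rw [lambdas, h]
  exact sortedEigenvalues_inv_mul_nonneg hW hB (hpos hkn) i

theorem concentrationMatrix_splits (Z : Matrix (Fin n) (Fin k) ℝ) (X : Matrix (Fin n) (Fin m) ℝ)
    (y : Fin n → ℝ) (β : Fin m → ℝ) : (concentrationMatrix Z X y β).charpoly.Splits := by
  obtain ⟨W, B, hW, hB, -, h⟩ := exists_concentrationMatrix_eq Z X y β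
  rw [h]
  exact charpoly_inv_mul_splits hW hB

variable {Ω : Type*} [MeasurableSpace Ω] {Z : Ω → Matrix (Fin n) (Fin k) ℝ}
  {X : Ω → Matrix (Fin n) (Fin m) ℝ} {y : Ω → Fin n → ℝ}

theorem measurableEntries_projZ (hZ : MeasurableEntries Z) :
    MeasurableEntries fun ω => projZ (Z ω) :=
  (hZ.mul (hZ.transpose.mul hZ).inv).mul hZ.transpose

theorem measurableEntries_annihZ (hZ : MeasurableEntries Z) :
    MeasurableEntries fun ω => annihZ (Z ω) :=
  (measurableEntries_const 1).sub (measurableEntries_projZ hZ)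

theorem measurable_residual (hX : MeasurableEntries X) (hy : ∀ i, Measurable fun ω => y ω i)
    (b : Fin m → ℝ) (i : Fin n) : Measurable fun ω => (y ω - X ω *ᵥ b) i := by
  simp only [Pi.sub_apply, Matrix.mulVec, dotProduct]
  exact (hy i).sub (Finset.measurable_sum _ fun j _ => (hX i j).mul_const _)

theorem measurable_explainedSS (hZ : MeasurableEntries Z) (hX : MeasurableEntries X)
    (hy : ∀ i, Measurable fun ω => y ω i) (b : Fin m → ℝ) :
    Measurable fun ω => explainedSS (Z ω) (X ω) (y ω) b :=
  (measurableEntries_projZ hZ).quadratic (measurable_residual hX hy b)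

theorem measurable_residualSS (hZ : MeasurableEntries Z) (hX : MeasurableEntries X)
    (hy : ∀ i, Measurable fun ω => y ω i) (b : Fin m → ℝ) :
    Measurable fun ω => residualSS (Z ω) (X ω) (y ω) b :=
  (measurableEntries_annihZ hZ).quadratic (measurable_residual hX hy b)

theorem measurable_likelihoodRatio (hZ : MeasurableEntries Z) (hX : MeasurableEntries X)
    (hy : ∀ i, Measurable fun ω => y ω i) (β : Fin m → ℝ) :
    Measurable fun ω => likelihoodRatio (Z ω) (X ω) (y ω) β := by
  obtain ⟨D, hDc, hDd⟩ := TopologicalSpace.exists_countable_dense (Fin m → ℝ)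
  have h : ∀ ω, (⨅ b : {b : Fin m → ℝ // residualSS (Z ω) (X ω) (y ω) b ≠ 0},
      explainedSS (Z ω) (X ω) (y ω) b.1 / residualSS (Z ω) (X ω) (y ω) b.1) =
      (⨅ d : D, if residualSS (Z ω) (X ω) (y ω) d.1 = 0 then ⊤ else
        ENNReal.ofReal (explainedSS (Z ω) (X ω) (y ω) d.1 /
          residualSS (Z ω) (X ω) (y ω) d.1)).toReal := fun ω =>
    iInf_ratio_eq_toReal_iInf hDd (by unfold residualSS; fun_prop) (by unfold explainedSS; fun_prop)
      (fun b => quadratic_annihZ_nonneg _ _) (fun b => quadratic_projZ_nonneg _ _)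
  simp only [likelihoodRatio, h]
  have := hDc.to_subtype
  refine Measurable.sub (((measurable_explainedSS hZ hX hy β).div
    (measurable_residualSS hZ hX hy β)).const_mul _) (Measurable.const_mul ?_ _)
  refine (Measurable.iInf fun d => ?_).ennreal_toReal
  exact Measurable.ite (measurable_residualSS hZ hX hy d.1 (measurableSet_singleton 0))
    measurable_const
    (((measurable_explainedSS hZ hX hy d.1).div (measurable_residualSS hZ hX hy d.1)).ennreal_ofReal)

theorem measurable_lambdas (hZ : MeasurableEntries Z) (hX : MeasurableEntries X)
    (hy : ∀ i, Measurable fun ω => y ω i) (β : Fin m → ℝ) :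
    Measurable fun ω => lambdas (Z ω) (X ω) (y ω) β := by
  have hT : MeasurableEntries fun ω => xTilde (Z ω) (X ω) (y ω) β := by
    refine hX.sub fun i j => ?_
    simp only [Matrix.vecMulVec_apply, Pi.smul_apply, smul_eq_mul]
    refine (measurable_residual hX hy β i).mul ((measurable_residualSS hZ hX hy β).inv.mul ?_)
    simp only [Matrix.vecMul, dotProduct]
    exact Finset.measurable_sum _ fun l _ => (measurable_residual hX hy β l).mul
      ((measurableEntries_annihZ hZ).mul hX l j)
  refine MeasurableEntries.measurable_sortedEigenvalues ?_ fun ω => concentrationMatrix_splits _ _ _ _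
  exact (((hT.transpose.mul (measurableEntries_annihZ hZ)).mul hT).inv.mul
    ((hT.transpose.mul (measurableEntries_projZ hZ)).mul hT)).const_smul _

end StatisticMeasurability

/-! ### Chi-squared laws from Gaussian coordinates -/

section ChiSquared

instance isProbabilityMeasure_chiSquared (d : ℕ) : IsProbabilityMeasure (chiSquared d) :=
  Measure.isProbabilityMeasure_map (Measurable.aemeasurable (by fun_prop))

theorem chiSquared_apply (d : ℕ) {s : Set ℝ} (hs : MeasurableSet s) :
    chiSquared d s = (Measure.pi fun _ : Fin d => gaussianReal 0 1) {x | ∑ i, x i ^ 2 ∈ s} := by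
  rw [chiSquared, Measure.map_apply (by fun_prop) hs]
  rfl

theorem chiSquared_one_apply {s : Set ℝ} (hs : MeasurableSet s) :
    chiSquared 1 s = gaussianReal 0 1 {x | x ^ 2 ∈ s} := by
  rw [chiSquared_apply 1 hs]
  have : {x : Fin 1 → ℝ | ∑ i, x i ^ 2 ∈ s} = Set.univ.pi fun _ => {x : ℝ | x ^ 2 ∈ s} := by
    ext x; simp
  rw [this, Measure.pi_pi]
  simp

theorem chiSquared_ae_nonneg (d : ℕ) : ∀ᵐ x ∂(chiSquared d), 0 ≤ x := by
  rw [chiSquared, ae_map_iff (Measurable.aemeasurable (by fun_prop)) (measurableSet_Ici (a := (0 : ℝ)))]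
  exact Eventually.of_forall fun x => Finset.sum_nonneg fun i _ => sq_nonneg _

/-- The coordinates of a standard Gaussian in any orthonormal basis are independent standard
normals. The right side does not involve `b`, which is the source of the independence of `q` and
`Λ`. -/
theorem map_chiCoordinates {E : Type*} [NormedAddCommGroup E] [InnerProductSpace ℝ E]
    [FiniteDimensional ℝ E] [MeasurableSpace E] [BorelSpace E] {m r : ℕ}
    (b : OrthonormalBasis (Fin m ⊕ Fin r) ℝ E) :
    (stdGaussian E).map (chiCoordinates b) =
      Measure.pi (Fin.cons (chiSquared r) fun _ => chiSquared 1 : Fin (m + 1) → Measure ℝ) := by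
  have hm : Measurable (chiCoordinates b) := by
    refine measurable_pi_lambda _ fun i => ?_
    refine Fin.cases ?_ (fun j => ?_) i
    · simp only [chiCoordinates, Fin.cons_zero]; fun_prop
    · simp only [chiCoordinates, Fin.cons_succ]; fun_prop
  have : ∀ i, IsProbabilityMeasure
      ((Fin.cons (chiSquared r) fun _ => chiSquared 1 : Fin (m + 1) → Measure ℝ) i) := fun i =>
    Fin.cases (by rw [Fin.cons_zero]; infer_instance)
      (fun j => by rw [Fin.cons_succ]; infer_instance) i
  symm
  refine Measure.pi_eq fun s hs => ?_
  rw [stdGaussian_eq_map_pi_orthonormalBasis b, Measure.map_map hm (by fun_prop),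
    Measure.map_apply (hm.comp (by fun_prop)) (MeasurableSet.univ_pi hs)]
  have hc : ∀ x : Fin m ⊕ Fin r → ℝ, ∀ i, inner ℝ (b i) (∑ j, x j • b j) = x i := by
    intro x i
    rw [inner_sum]
    simp [inner_smul_right, b.inner_eq_ite]
  have hpre : (chiCoordinates b ∘ fun x : Fin m ⊕ Fin r → ℝ => ∑ i, x i • b i) ⁻¹'
      (Set.univ.pi s) = (MeasurableEquiv.sumPiEquivProdPi fun _ : Fin m ⊕ Fin r => ℝ) ⁻¹'
        ((Set.univ.pi fun j : Fin m => {x : ℝ | x ^ 2 ∈ s j.succ}) ×ˢ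
          {x : Fin r → ℝ | ∑ i, x i ^ 2 ∈ s 0}) := by
    ext x
    simp only [Set.mem_preimage, Function.comp, Set.mem_univ_pi, Fin.forall_fin_succ,
      chiCoordinates, hc, Fin.cons_zero, Fin.cons_succ, Set.mem_prod]
    exact and_comm
  rw [hpre, (measurePreserving_sumPiEquivProdPi
    fun _ : Fin m ⊕ Fin r => gaussianReal 0 1).measure_preimage_equiv, Measure.prod_prod,
    Measure.pi_pi, Fin.prod_univ_succ, mul_comm, Fin.cons_zero, chiSquared_apply r (hs 0)]
  congr 1
  refine Finset.prod_congr rfl fun j _ => ?_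
  rw [Fin.cons_succ, chiSquared_one_apply (hs _)]

end ChiSquared

/-! ### Splitting the Gaussian limit of `Ψ` -/

section GaussianDecomposition

variable {k m : ℕ}

theorem quadratic_kronecker_one {p : ℕ} (A : Matrix (Fin p) (Fin p) ℝ) (x : Fin p × Fin k → ℝ) :
    x ⬝ᵥ ((A ⊗ₖ (1 : Matrix (Fin k) (Fin k) ℝ)) *ᵥ x) =
      ∑ i, (fun j => x (j, i)) ⬝ᵥ (A *ᵥ fun j => x (j, i)) := by
  simp only [dotProduct, Matrix.mulVec, Fintype.sum_prod_type, Matrix.kroneckerMap_apply,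
    Matrix.one_apply, mul_ite, mul_one, mul_zero, ite_mul, zero_mul, Finset.sum_ite_eq,
    Finset.mem_univ, if_true]
  rw [Finset.sum_comm]

/-- Completing the square in the first coordinate. For characteristic functions this separates the
variance carried by `ξ` from the variance of the regression residual. -/
theorem quadratic_eq_condCov {W : Matrix (Fin (m + 1)) (Fin (m + 1)) ℝ} (hW : W.PosDef)
    (x : Fin (m + 1) → ℝ) :
    x ⬝ᵥ (W *ᵥ x) = (Real.sqrt (W 0 0) * x 0 + ∑ j, W 0 (Fin.succ j) / Real.sqrt (W 0 0) * x j.succ) ^ 2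
      + (fun j : Fin m => x j.succ) ⬝ᵥ (condCov W *ᵥ fun j => x j.succ) := by
  have hpos : 0 < W 0 0 := hW.diag_pos
  have hs : Real.sqrt (W 0 0) ≠ 0 := (Real.sqrt_pos.2 hpos).ne'
  have hsq := Real.sq_sqrt hpos.le
  have hsymm : ∀ i j, W i j = W j i := fun i j =>
    congrFun (congrFun (posDef_iff_mem_positiveForms.1 hW).1 j) i
  set o := ∑ j : Fin m, W 0 j.succ * x j.succ with ho
  have h1 : ∑ j : Fin m, W 0 j.succ / Real.sqrt (W 0 0) * x j.succ = o / Real.sqrt (W 0 0) := by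
    rw [ho, Finset.sum_div]
    exact Finset.sum_congr rfl fun j _ => by ring
  have h2 : (fun j : Fin m => x j.succ) ⬝ᵥ (condCov W *ᵥ fun j => x j.succ) =
      ∑ i : Fin m, ∑ j : Fin m, x i.succ * W i.succ j.succ * x j.succ - o * o / W 0 0 := by
    rw [ho, Finset.sum_mul_sum, Finset.sum_div, ← Finset.sum_sub_distrib]
    simp only [dotProduct, Matrix.mulVec, condCov, Matrix.of_apply, Finset.mul_sum]
    refine Finset.sum_congr rfl fun i _ => ?_
    rw [Finset.sum_div, ← Finset.sum_sub_distrib]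
    refine Finset.sum_congr rfl fun j _ => ?_
    rw [hsymm i.succ 0]
    ring
  have h3 : x ⬝ᵥ (W *ᵥ x) = W 0 0 * x 0 ^ 2 + 2 * x 0 * o +
      ∑ i : Fin m, ∑ j : Fin m, x i.succ * W i.succ j.succ * x j.succ := by
    have e1 : ∑ i : Fin m, x i.succ * (W i.succ 0 * x 0 + ∑ j : Fin m, W i.succ j.succ * x j.succ) =
        x 0 * o + ∑ i : Fin m, ∑ j : Fin m, x i.succ * W i.succ j.succ * x j.succ := by
      rw [ho, Finset.mul_sum, ← Finset.sum_add_distrib]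
      refine Finset.sum_congr rfl fun i _ => ?_
      rw [mul_add, Finset.mul_sum, hsymm i.succ 0]
      congr 1
      · ring
      · exact Finset.sum_congr rfl fun j _ => by ring
    simp only [dotProduct, Matrix.mulVec, Fin.sum_univ_succ, e1]
    rw [← ho]
    ring
  rw [h1, h2, h3, add_sq, mul_pow, hsq, div_pow, hsq]
  field_simp
  ring

/-- The vectorised `Ψ` built from its normalised first column `ξ` and a matrix `g` with mean `μ`. -/
noncomputable def psiOfPair (Om : Matrix (Fin (m + 1)) (Fin (m + 1)) ℝ)
    (μ : EuclideanSpace ℝ (Fin m × Fin k))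
    (z : EuclideanSpace ℝ (Fin k) × EuclideanSpace ℝ (Fin m × Fin k)) :
    EuclideanSpace ℝ (Fin (m + 1) × Fin k) :=
  WithLp.toLp 2 fun p => (Fin.cons (Real.sqrt (Om 0 0) * z.1 p.2) fun j =>
    z.2 (j, p.2) - μ (j, p.2) + Om 0 (Fin.succ j) / Real.sqrt (Om 0 0) * z.1 p.2 :
      Fin (m + 1) → ℝ) p.1

@[simp] theorem psiOfPair_zero (Om : Matrix (Fin (m + 1)) (Fin (m + 1)) ℝ)
    (μ : EuclideanSpace ℝ (Fin m × Fin k))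
    (z : EuclideanSpace ℝ (Fin k) × EuclideanSpace ℝ (Fin m × Fin k)) (i : Fin k) :
    psiOfPair Om μ z (0, i) = Real.sqrt (Om 0 0) * z.1 i := rfl

@[simp] theorem psiOfPair_succ (Om : Matrix (Fin (m + 1)) (Fin (m + 1)) ℝ)
    (μ : EuclideanSpace ℝ (Fin m × Fin k))
    (z : EuclideanSpace ℝ (Fin k) × EuclideanSpace ℝ (Fin m × Fin k)) (j : Fin m) (i : Fin k) :
    psiOfPair Om μ z (j.succ, i) =
      z.2 (j, i) - μ (j, i) + Om 0 j.succ / Real.sqrt (Om 0 0) * z.1 i := rfl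

theorem continuous_psiOfPair (Om : Matrix (Fin (m + 1)) (Fin (m + 1)) ℝ)
    (μ : EuclideanSpace ℝ (Fin m × Fin k)) : Continuous (psiOfPair Om μ) := by
  refine (PiLp.continuous_toLp 2 _).comp (continuous_pi fun p => ?_)
  obtain ⟨l, i⟩ := p
  refine Fin.cases ?_ (fun j => ?_) l
  · simp only [Fin.cons_zero]; fun_prop
  · simp only [Fin.cons_succ]; fun_prop

/-- Both sides have the same characteristic function. Pairing `psiOfPair` with `t` splits into
pairings with `ξ` along `u` and with the centred `g` along `w`, so the transform factors by
independence. -/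
theorem map_psiOfPair {Om : Matrix (Fin (m + 1)) (Fin (m + 1)) ℝ} (hOm : Om.PosDef)
    (μ : EuclideanSpace ℝ (Fin m × Fin k)) :
    ((stdGaussian (EuclideanSpace ℝ (Fin k))).prod
      (multivariateGaussian μ (condCov Om ⊗ₖ (1 : Matrix (Fin k) (Fin k) ℝ)))).map
        (psiOfPair Om μ) =
      multivariateGaussian 0 (Om ⊗ₖ (1 : Matrix (Fin k) (Fin k) ℝ)) := by
  have : IsProbabilityMeasure (((stdGaussian (EuclideanSpace ℝ (Fin k))).prod
      (multivariateGaussian μ (condCov Om ⊗ₖ (1 : Matrix (Fin k) (Fin k) ℝ)))).map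
        (psiOfPair Om μ)) :=
    Measure.isProbabilityMeasure_map (continuous_psiOfPair Om μ).aemeasurable
  apply Measure.ext_of_charFun
  funext t
  set u : EuclideanSpace ℝ (Fin k) := WithLp.toLp 2 fun i => Real.sqrt (Om 0 0) * t (0, i) +
    ∑ j : Fin m, Om 0 j.succ / Real.sqrt (Om 0 0) * t (j.succ, i) with hu
  set w : EuclideanSpace ℝ (Fin m × Fin k) := WithLp.toLp 2 fun p => t (p.1.succ, p.2) with hw
  have hin : ∀ z : EuclideanSpace ℝ (Fin k) × EuclideanSpace ℝ (Fin m × Fin k),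
      inner ℝ (psiOfPair Om μ z) t = inner ℝ z.1 u + (inner ℝ z.2 w - inner ℝ μ w) := by
    intro z
    simp only [PiLp.inner_apply, Fintype.sum_prod_type, Fin.sum_univ_succ, psiOfPair_zero,
      psiOfPair_succ, hu, hw, RCLike.inner_apply, conj_trivial, add_mul, Finset.sum_add_distrib,
      Finset.sum_mul, mul_add, mul_sub, Finset.sum_sub_distrib]
    have h1 : ∑ x : Fin k, ∑ i : Fin m, Om 0 i.succ / Real.sqrt (Om 0 0) * t (i.succ, x) * z.1 x =
        ∑ i : Fin m, ∑ x : Fin k, t (i.succ, x) * (Om 0 i.succ / Real.sqrt (Om 0 0) * z.1 x) := by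
      rw [Finset.sum_comm]
      exact Finset.sum_congr rfl fun i _ => Finset.sum_congr rfl fun x _ => by ring
    have h2 : ∑ x : Fin k, t (0, x) * (Real.sqrt (Om 0 0) * z.1 x) =
        ∑ x : Fin k, Real.sqrt (Om 0 0) * t (0, x) * z.1 x :=
      Finset.sum_congr rfl fun x _ => by ring
    rw [h1, h2]
    ring
  have hquad : ‖u‖ ^ 2 + w ⬝ᵥ ((condCov Om ⊗ₖ (1 : Matrix (Fin k) (Fin k) ℝ)) *ᵥ w) =
      t ⬝ᵥ ((Om ⊗ₖ (1 : Matrix (Fin k) (Fin k) ℝ)) *ᵥ t) := by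
    rw [quadratic_kronecker_one, quadratic_kronecker_one, EuclideanSpace.real_norm_sq_eq,
      ← Finset.sum_add_distrib]
    exact Finset.sum_congr rfl fun i _ => (quadratic_eq_condCov hOm fun j => t (j, i)).symm
  rw [charFun_multivariateGaussian (hOm.posSemidef.kronecker Matrix.PosSemidef.one), charFun_apply,
    integral_map (continuous_psiOfPair Om μ).aemeasurable (by fun_prop)]
  have hexp : ∀ z : EuclideanSpace ℝ (Fin k) × EuclideanSpace ℝ (Fin m × Fin k),
      Complex.exp ((inner ℝ (psiOfPair Om μ z) t : ℝ) * Complex.I) =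
      Complex.exp ((inner ℝ z.1 u : ℝ) * Complex.I) *
        (Complex.exp ((inner ℝ z.2 w : ℝ) * Complex.I) *
          Complex.exp (-((inner ℝ μ w : ℝ) * Complex.I))) := by
    intro z
    rw [hin, ← Complex.exp_add, ← Complex.exp_add]
    congr 1
    push_cast
    ring
  simp only [hexp]
  rw [integral_prod_mul (fun x : EuclideanSpace ℝ (Fin k) =>
      Complex.exp ((inner ℝ x u : ℝ) * Complex.I))
    (fun x : EuclideanSpace ℝ (Fin m × Fin k) => Complex.exp ((inner ℝ x w : ℝ) * Complex.I) *
      Complex.exp (-((inner ℝ μ w : ℝ) * Complex.I))), integral_mul_const, ← charFun_apply,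
    ← charFun_apply, charFun_stdGaussian, charFun_multivariateGaussian
      ((condCov_posDef hOm).posSemidef.kronecker Matrix.PosSemidef.one), ← Complex.exp_add,
    ← Complex.exp_add, ← hquad]
  congr 1
  rw [real_inner_comm]
  push_cast
  simp
  ring

end GaussianDecomposition

/-! ### The statistics as a continuous function of the moments -/

section MomentMap

variable {k m : ℕ}

/-- Index set for the entries of `(ε V)ᵀ (ε V) / n`, those of `Zᵀ Z / n`, and `1 / n`. -/
abbrev MomentIndex (k m : ℕ) : Type := (Fin (m + 1) × Fin (m + 1)) ⊕ (Fin k × Fin k) ⊕ Unit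

/-- The moments from which the statistics are computed. -/
abbrev MomentSpace (k m : ℕ) : Type :=
  EuclideanSpace ℝ (Fin (m + 1) × Fin k) × (MomentIndex k m → ℝ)

/-- The matrix with vectorisation `p.1`. -/
def psiPart (p : MomentSpace k m) : Matrix (Fin k) (Fin (m + 1)) ℝ :=
  Matrix.of fun i j => p.1 (j, i)

/-- The error moments. -/
def errorPart (p : MomentSpace k m) : Matrix (Fin (m + 1)) (Fin (m + 1)) ℝ :=
  Matrix.of fun i j => p.2 (Sum.inl (i, j))

/-- The instrument moments. -/
def instrumentPart (p : MomentSpace k m) : Matrix (Fin k) (Fin k) ℝ :=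
  Matrix.of fun i j => p.2 (Sum.inr (Sum.inl (i, j)))

/-- The inverse sample size. -/
def sizePart (p : MomentSpace k m) : ℝ := p.2 (Sum.inr (Sum.inr ()))

theorem continuous_psiPart : Continuous (psiPart (k := k) (m := m)) :=
  continuous_matrix fun i j => by simp only [psiPart, Matrix.of_apply]; fun_prop

theorem continuous_errorPart : Continuous (errorPart (k := k) (m := m)) :=
  continuous_matrix fun i j => by simp only [errorPart, Matrix.of_apply]; fun_prop

theorem continuous_instrumentPart : Continuous (instrumentPart (k := k) (m := m)) :=
  continuous_matrix fun i j => by simp only [instrumentPart, Matrix.of_apply]; fun_prop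

theorem continuous_sizePart : Continuous (sizePart (k := k) (m := m)) := by
  unfold sizePart; fun_prop

/-- The eigenvalues and the likelihood ratio as functions of the moments. -/
noncomputable def momentMap (Pi0 : Matrix (Fin k) (Fin m) ℝ) (p : MomentSpace k m) :
    (Fin m → ℝ) × ℝ :=
  (momentLambdas (sampleS Pi0 (psiPart p) (instrumentPart p))
      (sampleW (psiPart p) (errorPart p) (sizePart p)),
    momentLR (sampleS Pi0 (psiPart p) (instrumentPart p))
      (sampleW (psiPart p) (errorPart p) (sizePart p)))

/-- The moments with positive quadratic forms. -/
def regularMoments (k m : ℕ) : Set (MomentSpace k m) :=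
  {p | 0 < 1 - k * sizePart p ∧ instrumentPart p ∈ positiveForms k ∧
    errorPart p - sizePart p • ((psiPart p)ᵀ * psiPart p) ∈ positiveForms (m + 1)}

/-- The moments with symmetric matrices. -/
def symmetricMoments (k m : ℕ) : Set (MomentSpace k m) :=
  {p | (errorPart p)ᵀ = errorPart p ∧ (instrumentPart p)ᵀ = instrumentPart p}

theorem isOpen_regularMoments : IsOpen (regularMoments k m) := by
  have h1 := continuous_psiPart (k := k) (m := m)
  have h2 := continuous_errorPart (k := k) (m := m)
  have h3 := continuous_sizePart (k := k) (m := m)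
  have h4 : Continuous fun p : MomentSpace k m => 1 - (k : ℝ) * sizePart p :=
    continuous_const.sub (continuous_const.mul h3)
  have h5 : Continuous fun p : MomentSpace k m =>
      errorPart p - sizePart p • ((psiPart p)ᵀ * psiPart p) :=
    h2.sub (h3.smul (h1.matrix_transpose.matrix_mul h1))
  exact (isOpen_lt continuous_const h4).inter
    ((isOpen_positiveForms.preimage continuous_instrumentPart).inter
      (isOpen_positiveForms.preimage h5))

theorem instrumentPart_posDef {p : MomentSpace k m}
    (hp : p ∈ regularMoments k m ∩ symmetricMoments k m) : (instrumentPart p).PosDef :=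
  posDef_iff_mem_positiveForms.2 ⟨hp.2.2, hp.1.2.1⟩

theorem sampleW_posDef {p : MomentSpace k m}
    (hp : p ∈ regularMoments k m ∩ symmetricMoments k m) :
    (sampleW (psiPart p) (errorPart p) (sizePart p)).PosDef := by
  refine Matrix.PosDef.smul (posDef_iff_mem_positiveForms.2 ⟨?_, hp.1.2.2⟩) (inv_pos.2 hp.1.1)
  rw [Matrix.transpose_sub, Matrix.transpose_smul, gram_transpose, hp.2.1]

theorem continuousOn_momentMap (Pi0 : Matrix (Fin k) (Fin m) ℝ) :
    ContinuousOn (momentMap Pi0) (regularMoments k m ∩ symmetricMoments k m) := by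
  have h1 := continuous_psiPart (k := k) (m := m)
  have h2 := continuous_errorPart (k := k) (m := m)
  have h3 := continuous_sizePart (k := k) (m := m)
  have hS : ContinuousOn (fun p : MomentSpace k m => sampleS Pi0 (psiPart p) (instrumentPart p))
      (regularMoments k m ∩ symmetricMoments k m) := by
    refine h1.continuousOn.add ?_
    have hs : ContinuousOn (fun p : MomentSpace k m => matSqrt (instrumentPart p) * Pi0)
        (regularMoments k m ∩ symmetricMoments k m) :=
      continuousOn_matrix_mul (continuousOn_matSqrt.comp continuous_instrumentPart.continuousOn
        fun p hp => (instrumentPart_posDef hp).posSemidef) continuousOn_const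
    refine continuousOn_pi.2 fun i => continuousOn_pi.2 fun j => ?_
    refine Fin.cases ?_ (fun j => ?_) j
    · simp only [padZero_zero]; fun_prop
    · simp only [padZero_succ]
      exact continuousOn_pi.1 (continuousOn_pi.1 hs i) j
  have hW : ContinuousOn (fun p : MomentSpace k m =>
      sampleW (psiPart p) (errorPart p) (sizePart p))
      (regularMoments k m ∩ symmetricMoments k m) := by
    have h4 : ContinuousOn (fun p : MomentSpace k m => (1 - (k : ℝ) * sizePart p)⁻¹)
        (regularMoments k m ∩ symmetricMoments k m) :=
      (continuous_const.sub (continuous_const.mul h3)).continuousOn.inv₀ fun p hp => hp.1.1.ne'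
    exact h4.smul (h2.sub (h3.smul (h1.matrix_transpose.matrix_mul h1))).continuousOn
  have hmaps : Set.MapsTo (fun p : MomentSpace k m =>
      (sampleS Pi0 (psiPart p) (instrumentPart p),
        sampleW (psiPart p) (errorPart p) (sizePart p)))
      (regularMoments k m ∩ symmetricMoments k m) {p | p.2.PosDef} := fun p hp =>
    sampleW_posDef hp
  have hL := continuousOn_momentLambdas.comp (hS.prodMk hW) hmaps
  have hR := continuousOn_momentLR.comp (hS.prodMk hW) hmaps
  exact hL.prodMk hR

end MomentMap

/-! ### Identification of the limit law -/

section LimitLaw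

variable {k m : ℕ}

theorem continuous_limitLambdas {Om : Matrix (Fin (m + 1)) (Fin (m + 1)) ℝ} (hOm : Om.PosDef) :
    Continuous (limitLambdas (k := k) Om) := by
  refine continuousOn_sortedEigenvalues.comp_continuous ?_
    fun g => charpoly_inv_mul_splits (condCov_posDef hOm) (gram_transpose _)
  have hG : Continuous fun g : EuclideanSpace ℝ (Fin m × Fin k) =>
      (Matrix.of fun i j => g (j, i) : Matrix (Fin k) (Fin m) ℝ) :=
    continuous_matrix fun i j => by simp only [Matrix.of_apply]; fun_prop
  exact continuous_const.matrix_mul (hG.matrix_transpose.matrix_mul hG)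

theorem limitLambdas_nonneg {Om : Matrix (Fin (m + 1)) (Fin (m + 1)) ℝ} (hOm : Om.PosDef)
    (g : EuclideanSpace ℝ (Fin m × Fin k)) (i : Fin m) : 0 ≤ limitLambdas Om g i :=
  sortedEigenvalues_inv_mul_nonneg (condCov_posDef hOm) (gram_transpose _)
    (gram_quadratic_nonneg _) i

/-- The moments whose random part is `psiOfPair` and whose other parts are at their limits. -/
noncomputable def limitMoments (Om : Matrix (Fin (m + 1)) (Fin (m + 1)) ℝ)
    (Q : Matrix (Fin k) (Fin k) ℝ) (Pi0 : Matrix (Fin k) (Fin m) ℝ)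
    (z : EuclideanSpace ℝ (Fin k) × EuclideanSpace ℝ (Fin m × Fin k)) : MomentSpace k m :=
  (psiOfPair Om (WithLp.toLp 2 (Matrix.vec (matSqrt Q * Pi0))) z,
    Sum.elim (fun p => Om p.1 p.2) (Sum.elim (fun p => Q p.1 p.2) fun _ => 0))

variable {Om : Matrix (Fin (m + 1)) (Fin (m + 1)) ℝ} {Q : Matrix (Fin k) (Fin k) ℝ}
  {Pi0 : Matrix (Fin k) (Fin m) ℝ}

theorem limitMoments_mem (hOm : Om.PosDef) (hQ : Q.PosDef)
    (z : EuclideanSpace ℝ (Fin k) × EuclideanSpace ℝ (Fin m × Fin k)) :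
    limitMoments Om Q Pi0 z ∈ regularMoments k m ∩ symmetricMoments k m := by
  have h1 : sizePart (limitMoments Om Q Pi0 z) = 0 := rfl
  have h2 : errorPart (limitMoments Om Q Pi0 z) = Om := rfl
  have h3 : instrumentPart (limitMoments Om Q Pi0 z) = Q := rfl
  rw [posDef_iff_mem_positiveForms] at hOm hQ
  refine ⟨⟨by rw [h1]; simp, h3 ▸ hQ.2, ?_⟩, h2.symm ▸ hOm.1, h3.symm ▸ hQ.1⟩
  rw [h1, h2, zero_smul, sub_zero]
  exact hOm.2

theorem continuous_limitMoments : Continuous (limitMoments Om Q Pi0) :=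
  (continuous_psiOfPair _ _).prodMk continuous_const

theorem chiCoordinates_nonneg {E : Type*} [NormedAddCommGroup E] [InnerProductSpace ℝ E] {r : ℕ}
    (b : OrthonormalBasis (Fin m ⊕ Fin r) ℝ E) (ξ : E) (i : Fin (m + 1)) :
    0 ≤ chiCoordinates b ξ i := by
  refine Fin.cases ?_ (fun j => ?_) i
  · simp only [chiCoordinates, Fin.cons_zero]
    exact Finset.sum_nonneg fun _ _ => sq_nonneg _
  · simp only [chiCoordinates, Fin.cons_succ]
    exact sq_nonneg _

/-- At the limit moments `W = Ω`, and right multiplication by `schurMatrix Ω` cancels the `ξ`-part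
of the last columns, leaving exactly `G`. -/
theorem momentMap_limitMoments (hmk : m ≤ k) (hOm : Om.PosDef)
    (g : EuclideanSpace ℝ (Fin m × Fin k)) :
    ∃ b : OrthonormalBasis (Fin m ⊕ Fin (k - m)) ℝ (EuclideanSpace ℝ (Fin k)),
      ∀ ξ, momentMap Pi0 (limitMoments Om Q Pi0 (ξ, g)) =
        (limitLambdas Om g, limitLRExt (limitLambdas Om g, chiCoordinates b ξ)) := by
  obtain ⟨b, hb⟩ := exists_basis_momentLR hmk hOm (Matrix.of fun i j => g (j, i))
  refine ⟨b, fun ξ => ?_⟩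
  set p := limitMoments Om Q Pi0 (ξ, g) with hp
  have h1 : sampleW (psiPart p) (errorPart p) (sizePart p) = Om := by
    have h1 : sizePart p = 0 := rfl
    have h2 : errorPart p = Om := rfl
    rw [sampleW, h1, h2]
    simp
  have hsq : Real.sqrt (Om 0 0) ≠ 0 := (Real.sqrt_pos.2 hOm.diag_pos).ne'
  have hS0 : ∀ i, sampleS Pi0 (psiPart p) (instrumentPart p) i 0 = Real.sqrt (Om 0 0) * ξ i := by
    intro i
    rw [sampleS, Matrix.add_apply, padZero_zero, add_zero]
    rfl
  have hSs : ∀ i (j : Fin m), sampleS Pi0 (psiPart p) (instrumentPart p) i j.succ =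
      g (j, i) + Om 0 j.succ / Real.sqrt (Om 0 0) * ξ i := by
    intro i j
    have h3 : instrumentPart p = Q := rfl
    have h4 : psiPart p i j.succ = g (j, i) - (matSqrt Q * Pi0) i j +
      Om 0 j.succ / Real.sqrt (Om 0 0) * ξ i := rfl
    rw [sampleS, Matrix.add_apply, padZero_succ, h3, h4]
    ring
  have hST : sampleS Pi0 (psiPart p) (instrumentPart p) * schurMatrix Om =
      Matrix.of fun i j => g (j, i) := by
    ext i j
    rw [mul_schurMatrix_apply, hS0, hSs, Matrix.of_apply]
    have hW : Om 0 j.succ / Om 0 0 = Om 0 j.succ / Real.sqrt (Om 0 0) / Real.sqrt (Om 0 0) := by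
      rw [div_div, Real.mul_self_sqrt (hOm.diag_pos (i := 0)).le]
    rw [hW]
    field_simp
    ring
  rw [momentMap, h1, hb _ ξ hST hS0, momentLambdas, hST, limitLRExt_eq
    (limitLambdas_nonneg hOm g) (chiCoordinates_nonneg b ξ)]
  rfl

/-- The limit statistics as functions of `g` and of the chi-squared variables. -/
noncomputable def limitPair (Om : Matrix (Fin (m + 1)) (Fin (m + 1)) ℝ)
    (z : EuclideanSpace ℝ (Fin m × Fin k) × (Fin (m + 1) → ℝ)) : (Fin m → ℝ) × ℝ :=
  (limitLambdas Om z.1, limitLRExt (limitLambdas Om z.1, z.2))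

theorem continuous_limitPair (hOm : Om.PosDef) : Continuous (limitPair (k := k) Om) := by
  have h := (continuous_limitLambdas (k := k) hOm).comp
    (continuous_fst (Y := Fin (m + 1) → ℝ))
  exact h.prodMk (continuous_limitLRExt.comp (h.prodMk continuous_snd))

/-- Fubini with `g` frozen: its basis is then fixed, and the coordinates of `ξ` have the same
chi-squared law for every `g`. Sections are compared one `g` at a time, so the basis need not depend
measurably on `g`. -/
theorem map_momentMap_limitMoments (hmk : m ≤ k) (hOm : Om.PosDef)
    (hF : Measurable fun z => momentMap Pi0 (limitMoments Om Q Pi0 z)) :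
    ((stdGaussian (EuclideanSpace ℝ (Fin k))).prod (limitGaussian Om Q Pi0)).map
        (fun z => momentMap Pi0 (limitMoments Om Q Pi0 z)) =
      ((limitGaussian Om Q Pi0).prod (Measure.pi (Fin.cons (chiSquared (k - m))
        fun _ => chiSquared 1 : Fin (m + 1) → Measure ℝ))).map (limitPair Om) := by
  have : ∀ i, IsProbabilityMeasure
      ((Fin.cons (chiSquared (k - m)) fun _ => chiSquared 1 : Fin (m + 1) → Measure ℝ) i) := fun i =>
    Fin.cases (by rw [Fin.cons_zero]; infer_instance)
      (fun j => by rw [Fin.cons_succ]; infer_instance) i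
  have hΦ := (continuous_limitPair (k := k) hOm).measurable
  ext B hB
  rw [Measure.map_apply hF hB, Measure.map_apply hΦ hB, Measure.prod_apply_symm (hF hB),
    Measure.prod_apply (hΦ hB)]
  refine lintegral_congr fun g => ?_
  obtain ⟨b, hb⟩ := momentMap_limitMoments (Q := Q) (Pi0 := Pi0) hmk hOm g
  have hc : Measurable (chiCoordinates b) := by
    refine measurable_pi_lambda _ fun i => ?_
    refine Fin.cases ?_ (fun j => ?_) i
    · simp only [chiCoordinates, Fin.cons_zero]; fun_prop
    · simp only [chiCoordinates, Fin.cons_succ]; fun_prop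
  rw [← map_chiCoordinates b, Measure.map_apply hc (measurable_prodMk_left (hΦ hB))]
  congr 1
  ext ξ
  simp only [Set.mem_preimage, hb]
  rfl

end LimitLaw

/-! ### Convergence of the sample moments and of the statistics -/

section SampleMoments

variable {Ω : Type*} [MeasurableSpace Ω] {P : Measure Ω} [IsProbabilityMeasure P] {k m : ℕ}
  {Pi0 : Matrix (Fin k) (Fin m) ℝ} {β₀ : Fin m → ℝ}
  {Z : (n : ℕ) → Ω → Matrix (Fin n) (Fin k) ℝ} {X : (n : ℕ) → Ω → Matrix (Fin n) (Fin m) ℝ}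
  {y : (n : ℕ) → Ω → Fin n → ℝ} {ε : (n : ℕ) → Ω → Fin n → ℝ}
  {V : (n : ℕ) → Ω → Matrix (Fin n) (Fin m) ℝ}
  {Om : Matrix (Fin (m + 1)) (Fin (m + 1)) ℝ} {Q : Matrix (Fin k) (Fin k) ℝ}

/-- The nonrandom-limit part of the sample moments. -/
noncomputable def sampleEntries (Z : (n : ℕ) → Ω → Matrix (Fin n) (Fin k) ℝ)
    (ε : (n : ℕ) → Ω → Fin n → ℝ) (V : (n : ℕ) → Ω → Matrix (Fin n) (Fin m) ℝ)
    (n : ℕ) (ω : Ω) : MomentIndex k m → ℝ :=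
  Sum.elim (fun p => ((n : ℝ)⁻¹ • ((errorMatrix (ε n ω) (V n ω))ᵀ * errorMatrix (ε n ω) (V n ω)))
      p.1 p.2)
    (Sum.elim (fun p => ((n : ℝ)⁻¹ • ((Z n ω)ᵀ * Z n ω)) p.1 p.2) fun _ => (n : ℝ)⁻¹)

/-- The sample moments. -/
noncomputable def sampleMoments (Z : (n : ℕ) → Ω → Matrix (Fin n) (Fin k) ℝ)
    (ε : (n : ℕ) → Ω → Fin n → ℝ) (V : (n : ℕ) → Ω → Matrix (Fin n) (Fin m) ℝ)
    (n : ℕ) (ω : Ω) : MomentSpace k m :=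
  (WithLp.toLp 2 (Matrix.vec (Psi (Z n ω) (ε n ω) (V n ω))), sampleEntries Z ε V n ω)

theorem sampleMoments_symmetric {Ω : Type*} {Z : (n : ℕ) → Ω → Matrix (Fin n) (Fin k) ℝ}
    {ε : (n : ℕ) → Ω → Fin n → ℝ} {V : (n : ℕ) → Ω → Matrix (Fin n) (Fin m) ℝ} (n : ℕ) (ω : Ω) :
    sampleMoments Z ε V n ω ∈ symmetricMoments k m := by
  constructor
  · show ((n : ℝ)⁻¹ • ((errorMatrix (ε n ω) (V n ω))ᵀ * errorMatrix (ε n ω) (V n ω)))ᵀ = _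
    rw [Matrix.transpose_smul, gram_transpose]
    rfl
  · show ((n : ℝ)⁻¹ • ((Z n ω)ᵀ * Z n ω))ᵀ = _
    rw [Matrix.transpose_smul, gram_transpose]
    rfl

theorem statistics_eq_momentMap (hmodel : Model Pi0 β₀ Z X y ε V) {n : ℕ} (hn : 0 < n) {ω : Ω}
    (h : sampleMoments Z ε V n ω ∈ regularMoments k m) :
    (lambdas (Z n ω) (X n ω) (y n ω) β₀, likelihoodRatio (Z n ω) (X n ω) (y n ω) β₀) =
      momentMap Pi0 (sampleMoments Z ε V n ω) := by
  have hmem : sampleMoments Z ε V n ω ∈ regularMoments k m ∩ symmetricMoments k m :=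
    ⟨h, sampleMoments_symmetric n ω⟩
  have hn' : (0 : ℝ) < n := by exact_mod_cast hn
  have hk : 0 < (n : ℝ) - k := by
    have h1 : 0 < 1 - (k : ℝ) * (n : ℝ)⁻¹ := h.1
    have h2 := mul_pos hn' h1
    have h3 : (n : ℝ) * (1 - k * (n : ℝ)⁻¹) = n - k := by field_simp
    rwa [h3] at h2
  have hZ : ((Z n ω)ᵀ * Z n ω).PosDef := by
    have h1 : ((n : ℝ)⁻¹ • ((Z n ω)ᵀ * Z n ω)).PosDef := instrumentPart_posDef hmem
    have h2 := h1.smul hn'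
    rwa [smul_smul, mul_inv_cancel₀ hn'.ne', one_smul] at h2
  have := statistics_eq hn hk hZ (hmodel.firstStage n ω) (hmodel.outcome n ω) rfl rfl
    (sampleW_posDef hmem)
  rw [this.1, this.2]
  rfl

theorem Model.measurableEntries_X (hmodel : Model Pi0 β₀ Z X y ε V) (n : ℕ) :
    MeasurableEntries (X n) := by
  rw [funext (hmodel.firstStage n)]
  exact (MeasurableEntries.mul (fun i j => hmodel.measurable_Z n i j)
    (measurableEntries_const _)).add fun i j => hmodel.measurable_V n i j

theorem Model.measurable_y (hmodel : Model Pi0 β₀ Z X y ε V) (n : ℕ) (i : Fin n) :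
    Measurable fun ω => y n ω i := by
  simp only [hmodel.outcome, Pi.add_apply, Matrix.mulVec, dotProduct]
  exact (Finset.measurable_sum _ fun j _ =>
    (hmodel.measurableEntries_X n i j).mul_const _).add (hmodel.measurable_ε n i)

theorem Model.measurable_statistics (hmodel : Model Pi0 β₀ Z X y ε V) (n : ℕ) :
    Measurable fun ω => (lambdas (Z n ω) (X n ω) (y n ω) β₀,
      likelihoodRatio (Z n ω) (X n ω) (y n ω) β₀) :=
  (measurable_lambdas (hmodel.measurable_Z n) (hmodel.measurableEntries_X n)
    (hmodel.measurable_y n) β₀).prodMk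
  (measurable_likelihoodRatio (hmodel.measurable_Z n) (hmodel.measurableEntries_X n)
    (hmodel.measurable_y n) β₀)

/-- Slutsky's theorem. The deterministic `1/n` is carried as a coordinate so that the finite-sample
corrections in `sampleW` belong to one fixed map, independent of `n`. -/
theorem tendstoInDistribution_sampleMoments (hmodel : Model Pi0 β₀ Z X y ε V)
    (hlim : LimitAssumption P Om Q Z ε V) :
    TendstoInDistribution (sampleMoments Z ε V) atTop (limitMoments Om Q Pi0) (fun _ => P)
      ((stdGaussian (EuclideanSpace ℝ (Fin k))).prod (limitGaussian Om Q Pi0)) := by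
  have h1 : TendstoInDistribution
      (fun (n : ℕ) ω => (WithLp.toLp 2 (Matrix.vec (Psi (Z n ω) (ε n ω) (V n ω))) :
        EuclideanSpace ℝ (Fin (m + 1) × Fin k))) atTop
      (psiOfPair Om (WithLp.toLp 2 (Matrix.vec (matSqrt Q * Pi0)))) (fun _ => P)
      ((stdGaussian (EuclideanSpace ℝ (Fin k))).prod (limitGaussian Om Q Pi0)) := by
    refine tendstoInDistribution_of_map_eq hlim.clt (continuous_psiOfPair _ _).aemeasurable ?_
    rw [Measure.map_id, limitGaussian, map_psiOfPair hlim.posDef_Om]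
  have hE : ∀ n, MeasurableEntries fun ω => errorMatrix (ε n ω) (V n ω) := by
    intro n i j
    refine Fin.cases ?_ (fun j => ?_) j
    · exact hmodel.measurable_ε n i
    · exact hmodel.measurable_V n i j
  have hZ : ∀ n, MeasurableEntries (Z n) := fun n => hmodel.measurable_Z n
  refine h1.prodMk_of_tendstoInMeasure_const _ (sampleEntries Z ε V) _ ?_ fun n => ?_
  · refine tendstoInMeasure_pi fun i => ?_
    rcases i with p | p | u
    · exact hlim.errors p.1 p.2
    · exact hlim.instruments p.1 p.2
    · intro δ hδ
      refine tendsto_const_nhds.congr' ?_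
      have h0 : Tendsto (fun n : ℕ => edist (n : ℝ)⁻¹ 0) atTop (𝓝 0) := by
        simpa using tendsto_inv_atTop_nhds_zero_nat (𝕜 := ℝ) |>.edist
          (tendsto_const_nhds (x := (0 : ℝ)))
      filter_upwards [h0.eventually_lt_const hδ] with n hn
      have : {ω : Ω | δ ≤ edist (sampleEntries Z ε V n ω (Sum.inr (Sum.inr u))) 0} = ∅ :=
        Set.eq_empty_of_forall_notMem fun ω hω => absurd hω (not_le.2 hn)
      exact (measure_mono_null this.subset measure_empty).symm
  · refine (measurable_pi_lambda _ fun i => ?_).aemeasurable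
    rcases i with p | p | u
    · exact ((hE n).transpose.mul (hE n)).const_smul _ p.1 p.2
    · exact ((hZ n).transpose.mul (hZ n)).const_smul _ p.1 p.2
    · exact measurable_const

/-- Joint convergence of the eigenvalues and the likelihood ratio. -/
theorem tendstoInDistribution_statistics (hmodel : Model Pi0 β₀ Z X y ε V)
    (hlim : LimitAssumption P Om Q Z ε V)
    {Ω' : Type*} [MeasurableSpace Ω'] {P' : Measure Ω'} [IsProbabilityMeasure P']
    {q : Fin (m + 1) → Ω' → ℝ} (hq₀ : HasLaw (q 0) (chiSquared (k - m)) P')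
    (hq : ∀ i : Fin m, HasLaw (q i.succ) (chiSquared 1) P') (hindep : iIndepFun q P') :
    TendstoInDistribution
      (fun (n : ℕ) ω => (lambdas (Z n ω) (X n ω) (y n ω) β₀,
        likelihoodRatio (Z n ω) (X n ω) (y n ω) β₀)) atTop
      (fun z : EuclideanSpace ℝ (Fin m × Fin k) × Ω' =>
        limitPair Om (z.1, fun i => q i z.2))
      (fun _ => P) ((limitGaussian Om Q Pi0).prod P') := by
  have hmk : m ≤ k := by
    have := Pi0.rank_le_height
    rwa [hmodel.fullRank] at this
  have hF : Continuous fun z => momentMap Pi0 (limitMoments Om Q Pi0 z) :=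
    (continuousOn_momentMap Pi0).comp_continuous continuous_limitMoments
      (limitMoments_mem hlim.posDef_Om hlim.posDef_Q)
  have key := tendstoInDistribution_of_continuousOn
    (T := fun n ω => (lambdas (Z n ω) (X n ω) (y n ω) β₀,
        likelihoodRatio (Z n ω) (X n ω) (y n ω) β₀))
    (tendstoInDistribution_sampleMoments hmodel hlim) isOpen_regularMoments
    (continuousOn_momentMap Pi0) sampleMoments_symmetric
    (by
      filter_upwards [eventually_gt_atTop 0] with n hn ω hω
      exact statistics_eq_momentMap hmodel hn hω)
    (Eventually.of_forall (limitMoments_mem hlim.posDef_Om hlim.posDef_Q))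
    (fun n => (hmodel.measurable_statistics n).aemeasurable) hF.aemeasurable
  have hqm : ∀ i, AEMeasurable (q i) P' := fun i =>
    Fin.cases hq₀.aemeasurable (fun j => (hq j).aemeasurable) i
  have hqm' : AEMeasurable (fun ω i => q i ω) P' := aemeasurable_pi_lambda _ hqm
  have hlaw : P'.map (fun ω i => q i ω) = Measure.pi (Fin.cons (chiSquared (k - m))
        fun _ => chiSquared 1 : Fin (m + 1) → Measure ℝ) := by
    rw [(iIndepFun_iff_map_fun_eq_pi_map hqm).1 hindep]
    congr 1
    funext i
    refine Fin.cases ?_ (fun j => ?_) i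
    · rw [Fin.cons_zero, hq₀.map_eq]
    · rw [Fin.cons_succ, (hq j).map_eq]
  have hpair : AEMeasurable (fun z : EuclideanSpace ℝ (Fin m × Fin k) × Ω' =>
      (z.1, fun i => q i z.2)) ((limitGaussian Om Q Pi0).prod P') :=
    measurable_fst.aemeasurable.prodMk (hqm'.comp_quasiMeasurePreserving
      Measure.quasiMeasurePreserving_snd)
  have hΦ := (continuous_limitPair (k := k) hlim.posDef_Om).measurable
  refine tendstoInDistribution_of_map_eq key (hΦ.comp_aemeasurable hpair) ?_
  rw [map_momentMap_limitMoments hmk hlim.posDef_Om hF.measurable, ← hlaw]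
  have hprod : (limitGaussian Om Q Pi0).prod (P'.map fun ω i => q i ω) =
      ((limitGaussian Om Q Pi0).prod P').map fun z => (z.1, fun i => q i z.2) := by
    -- The variables `q` are only almost everywhere measurable, so a measurable version is used for
    -- the pushforward of the product.
    have h1 : (fun z : EuclideanSpace ℝ (Fin m × Fin k) × Ω' => (z.1, fun i => q i z.2))
        =ᵐ[(limitGaussian Om Q Pi0).prod P'] Prod.map id (hqm'.mk _) := by
      filter_upwards [Measure.quasiMeasurePreserving_snd.ae hqm'.ae_eq_mk] with z hz
      rw [Prod.map_apply, ← hz]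
      rfl
    rw [Measure.map_congr h1, ← Measure.map_prod_map _ _ measurable_id hqm'.measurable_mk,
      Measure.map_id, Measure.map_congr hqm'.ae_eq_mk]
  rw [hprod, AEMeasurable.map_map_of_aemeasurable hΦ.aemeasurable hpair]
  rfl

end SampleMoments

/-! ### Conditional integrals and the main theorem -/

theorem integral_cond_eq {Ω : Type*} [MeasurableSpace Ω] {P : Measure Ω} {A : Set Ω}
    (hA : MeasurableSet A) (f : Ω → ℝ) :
    ∫ ω, f ω ∂(P[|A]) = (∫ ω, A.indicator (fun _ => (1 : ℝ)) ω ∂P)⁻¹ * ∫ ω, A.indicator f ω ∂P := by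
  rw [ProbabilityTheory.cond, integral_smul_measure, integral_indicator_const _ hA,
    integral_indicator hA, ENNReal.toReal_inv]
  simp [Measure.real]

theorem continuous_integral_comp {Ω' : Type*} [MeasurableSpace Ω'] {P' : Measure Ω'}
    [IsProbabilityMeasure P'] {E G : Type*} [TopologicalSpace E] [FirstCountableTopology E]
    [TopologicalSpace G] [MeasurableSpace G] [BorelSpace G] {Φ : E × G → ℝ}
    (hΦ : Continuous Φ) {C : ℝ}
    (hC : ∀ z, ‖Φ z‖ ≤ C) {q : Ω' → G} (hq : AEMeasurable q P') :
    Continuous fun x => ∫ ω, Φ (x, q ω) ∂P' := by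
  refine continuous_of_dominated (bound := fun _ => C) (fun x => ?_)
    (fun x => Eventually.of_forall fun ω => hC _) (integrable_const C)
    (Eventually.of_forall fun ω => by fun_prop)
  have : Continuous fun g => Φ (x, g) := by fun_prop
  exact (this.measurable.comp_aemeasurable hq).aestronglyMeasurable

end WeakIV

theorem theorem1 {k m : ℕ} (hm : 0 < m)
    {Ω : Type*} [MeasurableSpace Ω] (P : Measure Ω) [IsProbabilityMeasure P]
    (Pi0 : Matrix (Fin k) (Fin m) ℝ) (β₀ : Fin m → ℝ)
    (Z : (n : ℕ) → Ω → Matrix (Fin n) (Fin k) ℝ) (X : (n : ℕ) → Ω → Matrix (Fin n) (Fin m) ℝ)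
    (y : (n : ℕ) → Ω → Fin n → ℝ) (ε : (n : ℕ) → Ω → Fin n → ℝ)
    (V : (n : ℕ) → Ω → Matrix (Fin n) (Fin m) ℝ)
    (Om : Matrix (Fin (m + 1)) (Fin (m + 1)) ℝ) (Q : Matrix (Fin k) (Fin k) ℝ)
    (hmodel : Model Pi0 β₀ Z X y ε V) (hlim : LimitAssumption P Om Q Z ε V)
    {Ω' : Type*} [MeasurableSpace Ω'] (P' : Measure Ω') [IsProbabilityMeasure P']
    (q : Fin (m + 1) → Ω' → ℝ)
    (hq₀ : HasLaw (q 0) (chiSquared (k - m)) P')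
    (hq : ∀ i : Fin m, HasLaw (q i.succ) (chiSquared 1) P')
    (hindep : iIndepFun q P') :
    -- the smallest root exists and obeys the bounds
    (∀ (lam : Fin m → ℝ) (x : Fin (m + 1) → ℝ), Monotone lam → (∀ i, 0 ≤ lam i) → (∀ i, 0 ≤ x i) →
      IsLeast {μ : ℝ | (limitPoly lam x).IsRoot μ} (muMin lam x) ∧
      0 ≤ muMin lam x ∧ muMin lam x ≤ min (lam ⟨0, hm⟩) (x 0)) ∧
    -- joint convergence to a limit whose conditional law given the eigenvalues is the stated one
    TendstoInDistribution
      (fun (n : ℕ) ω => (lambdas (Z n ω) (X n ω) (y n ω) β₀,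
        likelihoodRatio (Z n ω) (X n ω) (y n ω) β₀)) atTop
      (fun z : EuclideanSpace ℝ (Fin m × Fin k) × Ω' =>
        (limitLambdas Om z.1, limitLR (limitLambdas Om z.1) (fun i => q i z.2)))
      (fun _ => P) ((limitGaussian Om Q Pi0).prod P') ∧
    -- convergence given the event that the eigenvalues lie in `A`
    (∀ A : Set (Fin m → ℝ), MeasurableSet A →
      limitGaussian Om Q Pi0 {g | limitLambdas Om g ∈ frontier A} = 0 →
      limitGaussian Om Q Pi0 {g | limitLambdas Om g ∈ A} ≠ 0 →
      ∀ f : ℝ →ᵇ ℝ, Tendsto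
        (fun n : ℕ => ∫ ω, f (likelihoodRatio (Z n ω) (X n ω) (y n ω) β₀)
          ∂(P[| {ω | lambdas (Z n ω) (X n ω) (y n ω) β₀ ∈ A}]))
        atTop
        (𝓝 (∫ g, ∫ ω', f (limitLR (limitLambdas Om g) (fun i => q i ω')) ∂P'
          ∂((limitGaussian Om Q Pi0)[| {g | limitLambdas Om g ∈ A}])))) ∧
    -- the same with the sample eigenvalues plugged into the limit law
    (∀ F : ((Fin m → ℝ) × ℝ) →ᵇ ℝ, Tendsto
      (fun n : ℕ =>
        (∫ ω, F (lambdas (Z n ω) (X n ω) (y n ω) β₀,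
          likelihoodRatio (Z n ω) (X n ω) (y n ω) β₀) ∂P)
        - ∫ ω, ∫ ω', F (lambdas (Z n ω) (X n ω) (y n ω) β₀,
            limitLR (lambdas (Z n ω) (X n ω) (y n ω) β₀) (fun i => q i ω')) ∂P' ∂P)
      atTop (𝓝 0)) := by
  have hOm := hlim.posDef_Om
  have hqm : ∀ i, AEMeasurable (q i) P' := fun i =>
    Fin.cases hq₀.aemeasurable (fun j => (hq j).aemeasurable) i
  have hqm' : AEMeasurable (fun ω i => q i ω) P' := aemeasurable_pi_lambda _ hqm
  -- `limitLRExt` is known to agree with `limitLR` only at nonnegative arguments.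
  have hqpos : ∀ᵐ ω ∂P', ∀ i, 0 ≤ q i ω := by
    refine ae_all_iff.2 fun i => ?_
    refine Fin.cases ?_ (fun j => ?_) i
    · exact ae_of_ae_map hq₀.aemeasurable (hq₀.map_eq ▸ chiSquared_ae_nonneg _)
    · exact ae_of_ae_map (hq j).aemeasurable ((hq j).map_eq ▸ chiSquared_ae_nonneg _)
  have hpair : ∀ᵐ ω ∂P', ∀ g : EuclideanSpace ℝ (Fin m × Fin k),
      limitPair Om (g, fun i => q i ω) =
        (limitLambdas Om g, limitLR (limitLambdas Om g) fun i => q i ω) := by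
    filter_upwards [hqpos] with ω hω g
    rw [limitPair, limitLRExt_eq (limitLambdas_nonneg hOm g) hω]
  have hconv : TendstoInDistribution
      (fun (n : ℕ) ω => (lambdas (Z n ω) (X n ω) (y n ω) β₀,
        likelihoodRatio (Z n ω) (X n ω) (y n ω) β₀)) atTop
      (fun z : EuclideanSpace ℝ (Fin m × Fin k) × Ω' =>
        (limitLambdas Om z.1, limitLR (limitLambdas Om z.1) (fun i => q i z.2)))
      (fun _ => P) ((limitGaussian Om Q Pi0).prod P') := by
    refine (tendstoInDistribution_statistics hmodel hlim hq₀ hq hindep).congr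
      (fun _ => EventuallyEq.rfl) ?_
    filter_upwards [Measure.quasiMeasurePreserving_snd.ae hpair] with z hz
    exact hz z.1
  refine ⟨fun lam x hmono hlam hx => ?_, hconv, fun A hA hfr hne f => ?_, fun F => ?_⟩
  · exact ⟨(isLeast_muMin (limitMatrix_charpoly_splits lam x) (charpoly_limitMatrix hlam hx)).1,
      muMin_nonneg hlam hx, le_min (muMin_le_lam hlam hx _) (muMin_le_q_zero hlam hx)⟩
  · have hfr' : ((limitGaussian Om Q Pi0).prod P')
        {z | limitLambdas Om z.1 ∈ frontier A} = 0 := by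
      have : {z : EuclideanSpace ℝ (Fin m × Fin k) × Ω' | limitLambdas Om z.1 ∈ frontier A} =
          {g | limitLambdas Om g ∈ frontier A} ×ˢ Set.univ := by
        ext z; simp
      rw [this, Measure.prod_prod, hfr, zero_mul]
    set B : Set (EuclideanSpace ℝ (Fin m × Fin k)) := {g | limitLambdas Om g ∈ A} with hB
    have hBm : MeasurableSet B := (continuous_limitLambdas hOm).measurable hA
    have hS : ∀ n, MeasurableSet {ω | lambdas (Z n ω) (X n ω) (y n ω) β₀ ∈ A} := fun n =>
      (hmodel.measurable_statistics n).fst hA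
    have hlimit : ∀ f : ℝ →ᵇ ℝ, Tendsto (fun n : ℕ => ∫ ω,
        {ω | lambdas (Z n ω) (X n ω) (y n ω) β₀ ∈ A}.indicator
          (fun ω => f (likelihoodRatio (Z n ω) (X n ω) (y n ω) β₀)) ω ∂P) atTop
        (𝓝 (∫ g, B.indicator (fun g => ∫ ω', f (limitLR (limitLambdas Om g)
          (fun i => q i ω')) ∂P') g ∂(limitGaussian Om Q Pi0))) := by
      intro f
      have h1 := tendsto_integral_indicator hconv hA hfr' f
      have hint : Integrable (fun z : EuclideanSpace ℝ (Fin m × Fin k) × Ω' =>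
          A.indicator (fun _ => f (limitLR (limitLambdas Om z.1) fun i => q i z.2))
            (limitLambdas Om z.1)) ((limitGaussian Om Q Pi0).prod P') := by
        refine Integrable.of_bound (C := ‖f‖) ?_ (Eventually.of_forall fun z =>
          (norm_indicator_le_norm_self _ _).trans (f.norm_coe_le_norm _))
        have hm : Measurable fun p : (Fin m → ℝ) × ℝ =>
            (A ×ˢ Set.univ).indicator (fun p : (Fin m → ℝ) × ℝ => f p.2) p :=
          (f.continuous.measurable.comp measurable_snd).indicator (hA.prod MeasurableSet.univ)
        refine (hm.comp_aemeasurable hconv.aemeasurable_limit).aestronglyMeasurable.congr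
          (Eventually.of_forall fun z => ?_)
        by_cases hz : limitLambdas Om z.1 ∈ A <;> simp [hz]
      rw [integral_prod _ hint] at h1
      refine Eq.mp ?_ h1
      congr 2
      refine integral_congr_ae (Eventually.of_forall fun g => ?_)
      by_cases hg : limitLambdas Om g ∈ A <;> simp [hB, hg]
    have h1 := hlimit (BoundedContinuousFunction.const ℝ 1)
    have hB1 : ∫ g, B.indicator (fun _ => (1 : ℝ)) g ∂(limitGaussian Om Q Pi0) ≠ 0 := by
      rw [integral_indicator_const _ hBm]
      simpa [Measure.real, ENNReal.toReal_eq_zero_iff] using hne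
    simp only [BoundedContinuousFunction.const_apply, integral_const, probReal_univ, one_smul] at h1
    rw [integral_cond_eq hBm]
    -- A conditional mean is a ratio: `hlimit` with the constant `1` treats the denominator, with
    -- `f` the numerator. If the event is null for some `n`, both expressions are zero by
    -- convention.
    refine ((h1.inv₀ hB1).mul (hlimit f)).congr fun n => ?_
    rw [integral_cond_eq (hS n)]
  · have hΦ : Continuous fun z : (Fin m → ℝ) × (Fin (m + 1) → ℝ) => F (z.1, limitLRExt z) :=
      F.continuous.comp (continuous_fst.prodMk continuous_limitLRExt)
    have hC : ∀ z : (Fin m → ℝ) × (Fin (m + 1) → ℝ), ‖F (z.1, limitLRExt z)‖ ≤ ‖F‖ :=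
      fun z => F.norm_coe_le_norm _
    -- Integrating out `q` leaves a bounded continuous function of the eigenvalues, by dominated
    -- convergence. Both expectations then converge to the same limit: one by the joint law, the
    -- other by the marginal law of the eigenvalues.
    set h : (Fin m → ℝ) →ᵇ ℝ := BoundedContinuousFunction.ofNormedAddCommGroup
      (fun lam => ∫ ω', F (lam, limitLRExt (lam, fun i => q i ω')) ∂P')
      (continuous_integral_comp hΦ hC hqm') ‖F‖ (fun lam => by
        refine (norm_integral_le_of_norm_le_const
          (Eventually.of_forall fun ω' => F.norm_coe_le_norm _)).trans ?_
        simp) with hh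
    have happ : ∀ lam : Fin m → ℝ, (∀ i, 0 ≤ lam i) →
        ∫ ω', F (lam, limitLR lam fun i => q i ω') ∂P' = h lam := by
      intro lam hlam
      refine integral_congr_ae ?_
      filter_upwards [hqpos] with ω' hω'
      rw [limitLRExt_eq hlam hω']
    have h1 := tendsto_integral_of_tendstoInDistribution hconv F
    have h2 := tendsto_integral_of_tendstoInDistribution
      (hconv.continuous_comp (g := Prod.fst) continuous_fst) h
    have h3 : ∫ z, F (limitLambdas Om z.1, limitLR (limitLambdas Om z.1) fun i => q i z.2)
        ∂((limitGaussian Om Q Pi0).prod P') =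
        ∫ z : EuclideanSpace ℝ (Fin m × Fin k) × Ω', h (limitLambdas Om z.1)
          ∂((limitGaussian Om Q Pi0).prod P') := by
      have hint : Integrable (fun z : EuclideanSpace ℝ (Fin m × Fin k) × Ω' =>
          F (limitLambdas Om z.1, limitLR (limitLambdas Om z.1) fun i => q i z.2))
          ((limitGaussian Om Q Pi0).prod P') :=
        Integrable.of_bound (F.continuous.measurable.comp_aemeasurable
          hconv.aemeasurable_limit).aestronglyMeasurable ‖F‖
          (Eventually.of_forall fun z => F.norm_coe_le_norm _)
      rw [integral_prod _ hint, integral_fun_fst (fun g => h (limitLambdas Om g))]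
      simp only [probReal_univ, one_smul]
      exact integral_congr_ae (Eventually.of_forall fun g => happ _ (limitLambdas_nonneg hOm g))
    have h4 := h1.sub h2
    simp only [Function.comp] at h4
    rw [h3, sub_self] at h4
    refine h4.congr' ?_
    -- For `n ≥ k` the sample eigenvalues are nonnegative at every outcome, so the extension may be
    -- replaced by `limitLR`.
    filter_upwards [eventually_ge_atTop k] with n hn
    congr 1
    exact integral_congr_ae (Eventually.of_forall fun ω =>
      (happ _ (lambdas_nonneg hn _ _ _ _)).symm)
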